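/- Let $q,\nu\in\mathbb{C}$ be generic: both are nonzero, $q$ is not a root of unity and $\nu\neq\pm q^{k}$ for every $k\in\mathbb{Z}$. For $n\ge 1$ let $BMW_n=BMW_n(q,\nu)$ be the Birman–Murakami–Wenzl algebra over $\mathbb{C}$, generated by invertible elements $\sigma_1,\dots,\sigma_{n-1}$ with the relations $\sigma_i\sigma_{i+1}\sigma_i=\sigma_{i+1}\sigma_i\sigma_{i+1}$, $\sigma_i\sigma_j=\sigma_j\sigma_i$ for $|i-j|>1$, $(\sigma_i-q)(\sigma_i+q^{-1})(\sigma_i-\nu)=0$ and $\kappa_i\sigma_{i+1}^{\pm1}\kappa_i=\nu^{\mp1}\kappa_i$, where $$\kappa_i:=\frac{(q-\sigma_i)(\sigma_i+q^{-1})}{\nu(q-q^{-1})}.$$ Its Jucys–Murphy elements are $y_1=1$ and $y_{k+1}=\sigma_k y_k\sigma_k$ for $k=1,\dots,n-1$. Let $\mathrm{Spec}(y_1,\dots,y_n)\subset\mathbb{C}^n$ be the set of all strings $(a_1,\dots,a_n)$ for which there are a finite-dimensional irreducible representation of $BMW_n$ and a nonzero vector $v$ in it with $y_jv=a_jv$ for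 all $j=1,\dots,n$; such a $v$ is called an eigenvector with string $(a_1,\dots,a_n)$. Let $\alpha=(a_1,\dots,a_n)\in\mathrm{Spec}(y_1,\dots,y_n)$. Then: 1. For every $j=1,\dots,n$, $a_j\in q^{2\mathbb{Z}}\cup\nu^2q^{2\mathbb{Z}}$. 2. For every $i=1,\dots,n-1$, $a_i\ne a_{i+1}$. 3. Let $1\le i\le n-1$ and $a_ia_{i+1}\neq\nu^2$. (a) If $a_{i+1}=q^{2}a_i$, then $\sigma_iv_\alpha=q\,v_\alpha$ and $\kappa_iv_\alpha=0$ for every eigenvector $v_\alpha$ with string $\alpha$; if $a_{i+1}=q^{-2}a_i$, then $\sigma_iv_\alpha=-q^{-1}v_\alpha$ and $\kappa_iv_\alpha=0$ for every such $v_\alpha$. (b) If $a_{i+1}\ne q^{2}a_i$ and $a_{i+1}\neq q^{-2}a_i$, then the string $\alpha'$ obtained from $\alpha$ by interchanging $a_i$ and $a_{i+1}$ also belongs to $\mathrm{Spec}(y_1,\dots,y_n)$, and $\kappa_iv_\alpha=0$, $\kappa_iv_{\alpha'}=0$ for all eigenvectors $v_\alpha$, $v_{\alpha'}$ with strings $\alpha$,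 $\alpha'$. 4. Let $1\le i\le n-1$ and $a_ia_{i+1}=\nu^2$. Then the set of all strings $\gamma=(c_1,\dots,c_n)\in\mathrm{Spec}(y_1,\dots,y_n)$ with $c_j=a_j$ for $j\ne i,i+1$ and $c_ic_{i+1}=\nu^2$ (it contains $\alpha$) is finite with an odd number $2m+1$ of elements, $m\ge0$. If these are $\alpha^{(1)},\dots,\alpha^{(2m+1)}$, with entries $a_i^{(k)},a_{i+1}^{(k)}$ in positions $i,i+1$, then $$\prod_{k=1}^{2m+1}a_i^{(k)}=\nu^{2m},\qquad \prod_{k=1}^{2m+1}a_{i+1}^{(k)}=\nu^{2m+2}.$$ -/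

import Mathlib

/-- Generators of the group algebra of the braid group on `M + 1` strands:
`pos i` stands for `σ_{i+1}` and `inv i` for its inverse, `i = 0, …, M - 1`. -/
inductive BMWGen (M : ℕ) : Type
  | pos (i : Fin M) : BMWGen M
  | inv (i : Fin M) : BMWGen M

/-- The expression `(q - s)(s + q⁻¹) / (ν (q - q⁻¹))` in a complex algebra. -/
noncomputable def kappaOf {A : Type*} [Ring A] [Algebra ℂ A] (q ν : ℂ) (s : A) : A :=
  (ν * (q - q⁻¹))⁻¹ • ((algebraMap ℂ A q - s) * (s + algebraMap ℂ A q⁻¹))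

/-- The free generator `σ_{i+1}`. -/
def freeSigma {M : ℕ} (i : Fin M) : FreeAlgebra ℂ (BMWGen M) :=
  FreeAlgebra.ι ℂ (BMWGen.pos i)

/-- The free generator standing for the inverse of `σ_{i+1}`. -/
def freeSigmaInv {M : ℕ} (i : Fin M) : FreeAlgebra ℂ (BMWGen M) :=
  FreeAlgebra.ι ℂ (BMWGen.inv i)

/-- Defining relations of the Birman-Murakami-Wenzl algebra on `M + 1` strands. -/
inductive BMWRel (q ν : ℂ) (M : ℕ) :
    FreeAlgebra ℂ (BMWGen M) → FreeAlgebra ℂ (BMWGen M) → Prop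
  | mul_inv (i : Fin M) : BMWRel q ν M (freeSigma i * freeSigmaInv i) 1
  | inv_mul (i : Fin M) : BMWRel q ν M (freeSigmaInv i * freeSigma i) 1
  | braid (i j : Fin M) (h : (i : ℕ) + 1 = j) :
      BMWRel q ν M (freeSigma i * freeSigma j * freeSigma i)
        (freeSigma j * freeSigma i * freeSigma j)
  | locality (i j : Fin M) (h : (i : ℕ) + 1 < j) :
      BMWRel q ν M (freeSigma i * freeSigma j) (freeSigma j * freeSigma i)
  | cubic (i : Fin M) :
      BMWRel q ν M
        ((freeSigma i - algebraMap ℂ _ q) * (freeSigma i + algebraMap ℂ _ q⁻¹) *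
          (freeSigma i - algebraMap ℂ _ ν)) 0
  | tangle (i j : Fin M) (h : (i : ℕ) + 1 = j) :
      BMWRel q ν M
        (kappaOf q ν (freeSigma i) * freeSigma j * kappaOf q ν (freeSigma i))
        (ν⁻¹ • kappaOf q ν (freeSigma i))
  | tangle_inv (i j : Fin M) (h : (i : ℕ) + 1 = j) :
      BMWRel q ν M
        (kappaOf q ν (freeSigma i) * freeSigmaInv j * kappaOf q ν (freeSigma i))
        (ν • kappaOf q ν (freeSigma i))

/-- The Birman-Murakami-Wenzl algebra `BMW_{M+1}(q, ν)` over `ℂ`, with `M` braid generators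
(that is, on `M + 1` strands). -/
abbrev BMWAlgebra (q ν : ℂ) (M : ℕ) : Type := RingQuot (BMWRel q ν M)

namespace BMWAlgebra

/-- The generator `σ_{i+1}` of `BMW_{M+1}(q, ν)`. -/
noncomputable def sigma (q ν : ℂ) {M : ℕ} (i : Fin M) : BMWAlgebra q ν M :=
  RingQuot.mkAlgHom ℂ (BMWRel q ν M) (freeSigma i)

/-- The element `κ_{i+1}` of `BMW_{M+1}(q, ν)`. -/
noncomputable def kappa (q ν : ℂ) {M : ℕ} (i : Fin M) : BMWAlgebra q ν M :=
  kappaOf q ν (sigma q ν i)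

/-- The Jucys-Murphy elements `y_1 = 1`, `y_{k+1} = σ_k y_k σ_k`; `jm q ν j` is `y_{j+1}`,
`j = 0, …, M`. -/
noncomputable def jm (q ν : ℂ) {M : ℕ} (j : Fin (M + 1)) : BMWAlgebra q ν M :=
  Fin.induction (motive := fun _ => BMWAlgebra q ν M) 1
    (fun k y => sigma q ν k * y * sigma q ν k) j

/-- A finite-dimensional irreducible complex representation of `BMW_{M+1}(q, ν)`. -/
structure Irrep (q ν : ℂ) (M : ℕ) where
  carrier : Type
  [addCommGroup : AddCommGroup carrier]
  [moduleComplex : Module ℂ carrier]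
  [moduleAlgebra : Module (BMWAlgebra q ν M) carrier]
  [scalarTower : IsScalarTower ℂ (BMWAlgebra q ν M) carrier]
  [finiteDimensional : FiniteDimensional ℂ carrier]
  [simple : IsSimpleModule (BMWAlgebra q ν M) carrier]

attribute [instance] Irrep.addCommGroup Irrep.moduleComplex Irrep.moduleAlgebra
  Irrep.scalarTower Irrep.finiteDimensional Irrep.simple

/-- `v` is a common eigenvector of the Jucys-Murphy elements with string of eigenvalues `α`. -/
def IsJMEigenvector {q ν : ℂ} {M : ℕ} (V : Irrep q ν M) (α : Fin (M + 1) → ℂ)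
    (v : V.carrier) : Prop :=
  v ≠ 0 ∧ ∀ j : Fin (M + 1), jm q ν j • v = α j • v

/-- The joint spectrum `Spec(y_1, …, y_{M+1})`: the set of strings of eigenvalues of all common
eigenvectors of the Jucys-Murphy elements in the irreducible representations. -/
def jmSpec (q ν : ℂ) (M : ℕ) : Set (Fin (M + 1) → ℂ) :=
  {α | ∃ (V : Irrep q ν M) (v : V.carrier), IsJMEigenvector V α v}

end BMWAlgebra

/-! Every string of eigenvalues is the content string of a walk on Young diagrams that adds or
removes one box at a time; the four claims are then read off from walks. A diagram is encoded by its
Maya diagram `χ : ℤ → Bool`, and a letter `(l, b)` exchanges the entries at `l` and `l + 1`: it adds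
a box of content `q ^ (2 * l)` or removes one, with content `ν ^ 2 * q ^ (-(2 * l))`. Genericity
makes contents determine letters, so a string determines its shapes. Indices start at 0, so `y 0 =
1`.

Two local mechanisms govern neighbouring eigenvalues. Since `κ i * (y i * y (i + 1)) = ν ^ 2 • κ i`,
the element `κ i` kills an eigenvector unless `a i * a (i + 1) = ν ^ 2`. When it kills `v`, `s i`
acts on `v` by Hecke rules: either a combination of `s i v` and `v` carries the transposed string,
or `v` is an eigenvector of `s i` and the two eigenvalues differ by the factor `q ^ (±2)`
(`hecke_alternative`). Otherwise the generating function of `κ i * y i ^ k * κ i` is used. One step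
of the walk multiplies it, after an affine normalization, by `stepFactor`, whose zeros and poles
follow the change of the shape; its poles at contents are therefore exactly those of the allowed
letters (`exists_generating_function`). A pole forces an eigenvector, so from one vector with `κ i v
≠ 0` all pairs "letter, inverse letter" arise (`kappa_move`).

That strings are walks is proved by induction on the length (`weightsArePaths`), jointly with the
absence of Jordan blocks. The delicate configuration has two adjacent edges both usable in one shape
(`allowed_of_adjacent`); it is settled by rerouting the beginning of the walk
(`exists_weight_ending_with`) and then using `κ p * κ (p + 1) * κ p = κ p` or the braid relation.

Claim 2 holds because a letter cannot be applied twice in succession. For claim 3, a transposed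
string with ratio `q ^ (±2)` would need two adjacent letters of the same kind allowed in one shape.
In claim 4 the strings correspond to the letters allowed in one shape; their number and the products
follow from two invariants of the descents, total 1 and first moment 0 (`exists_descent_finsupp`).
-/

/-- The genericity conditions on the parameters. -/
structure GenericParams (q ν : ℂ) : Prop where
  q_ne : q ≠ 0
  q_pow : ∀ k : ℕ, 0 < k → q ^ k ≠ 1
  nu_ne : ν ≠ 0
  nu_pow : ∀ k : ℤ, ν ≠ q ^ k ∧ ν ≠ -q ^ k

namespace GenericParams

variable {q ν : ℂ} (g : GenericParams q ν)
include g

lemma zpow_eq_one {k : ℤ} (h : q ^ k = 1) : k = 0 := by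
  by_contra hk
  have h1 : q ^ k.natAbs = 1 := by
    rcases Int.natAbs_eq k with h2 | h2
    · rw [h2] at h; exact_mod_cast h
    · rw [h2, zpow_neg, inv_eq_one] at h; exact_mod_cast h
  exact g.q_pow _ (Int.natAbs_pos.mpr hk) h1

lemma zpow_injective {k l : ℤ} (h : q ^ k = q ^ l) : k = l := by
  have : q ^ (k - l) = 1 := by
    rw [zpow_sub₀ g.q_ne, h, div_self (zpow_ne_zero _ g.q_ne)]
  have := g.zpow_eq_one this
  omega

/-- This is what keeps the contents of added boxes apart from those of removed boxes. -/
lemma nu_sq_ne (k : ℤ) : ν ^ 2 ≠ q ^ (2 * k) := by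
  intro h
  rw [mul_comm, zpow_mul] at h
  rcases sq_eq_sq_iff_eq_or_eq_neg.mp (by exact_mod_cast h : ν ^ 2 = (q ^ k) ^ 2) with h | h
  · exact (g.nu_pow k).1 h
  · exact (g.nu_pow k).2 h

lemma q_sq_ne_one : q ^ 2 ≠ 1 := g.q_pow 2 (by norm_num)

lemma q_sq_ne_neg_one : q ^ 2 ≠ -1 := by
  intro h
  apply g.q_pow 4 (by norm_num)
  rw [show (4 : ℕ) = 2 * 2 from rfl, pow_mul, h]; norm_num

lemma delta_ne : q - q⁻¹ ≠ 0 := by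
  have := g.q_ne
  intro h
  apply g.q_sq_ne_one
  field_simp at h
  linear_combination h

lemma q_ne_neg_inv : q ≠ -q⁻¹ := by
  have := g.q_ne
  intro h
  apply g.q_sq_ne_neg_one
  field_simp at h
  exact h

end GenericParams

/-! ### Relations in the algebra: skein, tangle and Jucys-Murphy identities -/

section Algebra

variable {A : Type*} [Ring A] [Algebra ℂ A]

/-- Elements of a complex algebra satisfying the defining relations of the
Birman-Murakami-Wenzl algebra with `M` braid generators. -/
structure BMWFamily (q ν : ℂ) (M : ℕ) (s t : ℕ → A) : Prop where
  mul_inv : ∀ i, i < M → s i * t i = 1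
  inv_mul : ∀ i, i < M → t i * s i = 1
  braid : ∀ i, i + 1 < M → s i * s (i + 1) * s i = s (i + 1) * s i * s (i + 1)
  locality : ∀ i j, i + 1 < j → j < M → s i * s j = s j * s i
  cubic : ∀ i, i < M →
    (s i - algebraMap ℂ A q) * (s i + algebraMap ℂ A q⁻¹) * (s i - algebraMap ℂ A ν) = 0
  tangle : ∀ i, i + 1 < M →
    kappaOf q ν (s i) * s (i + 1) * kappaOf q ν (s i) = ν⁻¹ • kappaOf q ν (s i)
  tangle_inv : ∀ i, i + 1 < M →
    kappaOf q ν (s i) * t (i + 1) * kappaOf q ν (s i) = ν • kappaOf q ν (s i)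

/-- The Jucys-Murphy elements attached to a sequence of elements of a ring. -/
def jucysMurphy (s : ℕ → A) : ℕ → A
  | 0 => 1
  | k + 1 => s k * jucysMurphy s k * s k

/-- The eigenvalue of `κ` on its image. -/
noncomputable def loopParam (q ν : ℂ) : ℂ := (ν * (q - q⁻¹))⁻¹ * ((q - ν) * (ν + q⁻¹))

namespace GenericParams

lemma delta_mul_loopParam {q ν : ℂ} (g : GenericParams q ν) :
    (q - q⁻¹) * loopParam q ν = (q - q⁻¹) + ν⁻¹ - ν := by
  have h1 := g.delta_ne
  have h2 := g.nu_ne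
  have h3 := g.q_ne
  have h4 : (q - q⁻¹) * loopParam q ν = ν⁻¹ * ((q - ν) * (ν + q⁻¹)) := by
    unfold loopParam
    rw [mul_inv]
    generalize q - q⁻¹ = d at h1 ⊢
    field_simp
  rw [h4]
  field_simp
  ring

end GenericParams

namespace BMWFamily

variable {q ν : ℂ} {M : ℕ} {s t : ℕ → A}

local notation:max "κ" i:max => kappaOf q ν (s i)
local notation:max "y" i:max => jucysMurphy s i

lemma kappaOf_eq (x : A) :
    kappaOf q ν x = (ν * (q - q⁻¹))⁻¹ • (q • x + (q * q⁻¹) • 1 - x * x - q⁻¹ • x) := by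
  unfold kappaOf
  simp only [Algebra.algebraMap_eq_smul_one, mul_add, sub_mul, smul_mul_assoc, one_mul,
    mul_smul_comm, mul_one]
  congr 1
  module

lemma commute_kappaOf {x z : A} (h : Commute x z) : Commute x (kappaOf q ν z) := by
  rw [kappaOf_eq]
  refine Commute.smul_right ?_ _
  exact (((h.smul_right _).add_right ((Commute.one_right x).smul_right _)).sub_right
    (h.mul_right h)).sub_right (h.smul_right _)

lemma semiconj_kappaOf {a x z : A} (h : a * x = z * a) :
    a * kappaOf q ν x = kappaOf q ν z * a := by
  have h2 : a * (x * x) = z * z * a := by rw [← mul_assoc, h, mul_assoc, h, mul_assoc]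
  simp only [kappaOf_eq, mul_smul_comm, smul_mul_assoc, mul_sub, sub_mul, mul_add, add_mul, h, h2,
    mul_one, one_mul]

variable (g : GenericParams q ν) (h : BMWFamily q ν M s t)
include g h

omit g in
lemma kappa_mul_sigma {i : ℕ} (hi : i < M) : κ i * s i = ν • κ i := by
  have h1 := h.cubic i hi
  have h2 : κ i * (s i - algebraMap ℂ A ν) = 0 := by
    unfold kappaOf
    rw [smul_mul_assoc]
    have : (algebraMap ℂ A q - s i) = -(s i - algebraMap ℂ A q) := by abel
    rw [this, neg_mul, neg_mul, h1, neg_zero, smul_zero]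
  rw [mul_sub, sub_eq_zero] at h2
  rw [h2, ← Algebra.commutes, Algebra.smul_def]

omit g h in
lemma sigma_commute_kappa (i : ℕ) : Commute (s i) (κ i) := commute_kappaOf (Commute.refl _)

omit g in
lemma sigma_mul_kappa {i : ℕ} (hi : i < M) : s i * κ i = ν • κ i := by
  rw [(sigma_commute_kappa i).eq, h.kappa_mul_sigma hi]

lemma kappa_sq {i : ℕ} (hi : i < M) : κ i * κ i = loopParam q ν • κ i := by
  have h1 := h.kappa_mul_sigma hi
  nth_rewrite 2 [kappaOf_eq]
  simp only [mul_smul_comm, mul_sub, mul_add, ← mul_assoc, h1, smul_mul_assoc, mul_one, loopParam]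
  have := g.q_ne
  have := g.nu_ne
  match_scalars
  ring

omit g in
lemma inv_unique {i : ℕ} (hi : i < M) {x : A} (hx : s i * x = 1) : x = t i := by
  rw [← one_mul x, ← h.inv_mul i hi, mul_assoc, hx, mul_one]

/-- The skein relation. -/
lemma inv_eq {i : ℕ} (hi : i < M) : t i = s i - (q - q⁻¹) • (1 : A) + (q - q⁻¹) • κ i := by
  symm
  apply h.inv_unique hi
  have hd := g.delta_ne
  have h2 := g.nu_ne
  have e : (q - q⁻¹) * (ν * (ν * (q - q⁻¹))⁻¹) = 1 := by
    generalize q - q⁻¹ = d at hd ⊢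
    field_simp
  have e2 : q * q⁻¹ = 1 := mul_inv_cancel₀ g.q_ne
  rw [mul_add, mul_sub, mul_smul_comm, mul_smul_comm, h.sigma_mul_kappa hi, kappaOf_eq, mul_one,
    smul_smul, smul_smul, mul_assoc, e, e2]
  module

lemma kappa_mul_inv {i : ℕ} (hi : i < M) : κ i * t i = ν⁻¹ • κ i := by
  have h1 := congrArg (· * t i) (h.kappa_mul_sigma hi)
  simp only [mul_assoc, h.mul_inv i hi, mul_one, smul_mul_assoc] at h1
  rw [eq_inv_smul_iff₀ g.nu_ne, ← h1]

/-- Substituting the skein relation for `t (i + 1)` in `tangle_inv` leaves a linear equation whose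
other terms are known from `tangle` and `kappa_sq`; the value of `loopParam` makes the coefficients
match. -/
lemma kappa_kappa_kappa {i : ℕ} (hi : i + 1 < M) : κ i * κ (i + 1) * κ i = κ i := by
  have hd := g.delta_ne
  have h1 := h.tangle i hi
  have h2 := h.tangle_inv i hi
  have h3 := h.kappa_sq g (by omega : i < M)
  rw [h.inv_eq g hi, mul_add, mul_sub, add_mul, sub_mul, h1, mul_smul_comm, mul_smul_comm,
    smul_mul_assoc, smul_mul_assoc, mul_one, h3, smul_smul, g.delta_mul_loopParam] at h2
  have h4 : (q - q⁻¹) • (κ i * κ (i + 1) * κ i) = (q - q⁻¹) • κ i := by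
    linear_combination (norm := module) h2
  exact smul_right_injective A hd h4

omit g in
lemma braid_kappa {i : ℕ} (hi : i + 1 < M) :
    s i * s (i + 1) * κ i = κ (i + 1) * (s i * s (i + 1)) :=
  semiconj_kappaOf (by rw [h.braid i hi, mul_assoc])

omit g in
lemma braid_kappa' {i : ℕ} (hi : i + 1 < M) :
    s (i + 1) * s i * κ (i + 1) = κ i * (s (i + 1) * s i) :=
  semiconj_kappaOf (by rw [← h.braid i hi, mul_assoc])

omit g in
lemma braid_inv {i : ℕ} (hi : i + 1 < M) :
    t (i + 1) * t i * κ (i + 1) = κ i * (t (i + 1) * t i) := by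
  have h1 := congrArg (fun x => t (i + 1) * t i * x * (t (i + 1) * t i)) (h.braid_kappa hi)
  have e1 : t (i + 1) * t i * (s i * s (i + 1)) = 1 := by
    rw [mul_assoc, ← mul_assoc (t i), h.inv_mul i (by omega), one_mul, h.inv_mul _ hi]
  have e2 : (s i * s (i + 1)) * (t (i + 1) * t i) = 1 := by
    rw [mul_assoc, ← mul_assoc (s (i + 1)), h.mul_inv _ hi, one_mul, h.mul_inv i (by omega)]
  rw [← mul_assoc _ (s i * s (i + 1)), e1, one_mul, mul_assoc, mul_assoc (κ (i + 1)), e2,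
    mul_one] at h1
  exact h1.symm

omit g in
/-- Interchanging two neighbouring generators again gives such a family. -/
lemma mirror {i : ℕ} (hi : i + 1 < M) :
    BMWFamily q ν 2 (fun n => if n = 0 then s (i + 1) else s i)
      (fun n => if n = 0 then t (i + 1) else t i) := by
  -- The half twist `D` intertwines `s i` and `s (i + 1)`, hence also `κ i` and `κ (i + 1)`.
  -- Carrying the tangle relations across it and cancelling `D` gives the mirrored ones.
  have hi' : i < M := by omega
  have hD : s i * s (i + 1) * s i * s i = s (i + 1) * (s i * s (i + 1) * s i) := by
    nth_rewrite 1 [h.braid i hi]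
    simp only [mul_assoc]
  have hD' : s i * s (i + 1) * s i * s (i + 1) = s i * (s i * s (i + 1) * s i) := by
    conv_rhs => rw [h.braid i hi]
    simp only [mul_assoc]
  have hK := semiconj_kappaOf (q := q) (ν := ν) hD
  have hDt : s i * s (i + 1) * s i * t (i + 1) = t i * (s i * s (i + 1) * s i) := by
    rw [h.braid i hi, mul_assoc, h.mul_inv _ hi, mul_one, ← h.braid i hi]
    simp only [← mul_assoc]
    rw [h.inv_mul i hi', one_mul]
  set D := s i * s (i + 1) * s i with hDdef
  have hDu : D * (t i * t (i + 1) * t i) = 1 := by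
    rw [hDdef]
    simp only [mul_assoc]
    rw [← mul_assoc (s i) (t i), h.mul_inv i hi', one_mul, ← mul_assoc (s (i + 1)), h.mul_inv _ hi,
      one_mul, h.mul_inv i hi']
  have key : ∀ x z : A, x * D = z * D → x = z := by
    intro x z hxz
    rw [← mul_one x, ← mul_one z, ← hDu, ← mul_assoc x, ← mul_assoc z, hxz]
  refine ⟨?_, ?_, ?_, ?_, ?_, ?_, ?_⟩
  · intro j hj; split_ifs; exacts [h.mul_inv _ hi, h.mul_inv _ hi']
  · intro j hj; split_ifs; exacts [h.inv_mul _ hi, h.inv_mul _ hi']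
  · intro j hj
    obtain rfl : j = 0 := by omega
    simpa using (h.braid i hi).symm
  · intro j k hj hk; omega
  · intro j hj; split_ifs; exacts [h.cubic _ hi, h.cubic _ hi']
  · intro j hj
    obtain rfl : j = 0 := by omega
    simp only [↓reduceIte, zero_add, one_ne_zero]
    apply key
    have := congrArg (D * ·) (h.tangle i hi)
    simp only [← mul_assoc, hK, mul_smul_comm] at this
    rw [mul_assoc _ D, hD', ← mul_assoc, mul_assoc _ D, hK] at this
    rw [smul_mul_assoc, ← this]
    simp only [mul_assoc]
  · intro j hj
    obtain rfl : j = 0 := by omega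
    simp only [↓reduceIte, zero_add, one_ne_zero]
    apply key
    have := congrArg (D * ·) (h.tangle_inv i hi)
    simp only [← mul_assoc, hK, mul_smul_comm] at this
    rw [mul_assoc _ D, hDt, ← mul_assoc, mul_assoc _ D, hK] at this
    rw [smul_mul_assoc, ← this]
    simp only [mul_assoc]

lemma kappa_kappa_kappa' {i : ℕ} (hi : i + 1 < M) : κ (i + 1) * κ i * κ (i + 1) = κ (i + 1) := by
  simpa using (h.mirror hi).kappa_kappa_kappa g (i := 0) (by norm_num)

omit g in
lemma tangle' {i : ℕ} (hi : i + 1 < M) :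
    κ (i + 1) * s i * κ (i + 1) = ν⁻¹ • κ (i + 1) := by
  simpa using (h.mirror hi).tangle 0 (by norm_num)

omit g in
lemma tangle_inv' {i : ℕ} (hi : i + 1 < M) :
    κ (i + 1) * t i * κ (i + 1) = ν • κ (i + 1) := by
  simpa using (h.mirror hi).tangle_inv 0 (by norm_num)

/-- The braid relation and `tangle'` show that `κ (i + 1)` times the left side is `κ (i + 1)`.
Multiplying by `κ i` on the left and using `kappa_kappa_kappa` removes the extra factor. -/
lemma kappa_sigma_sigma {i : ℕ} (hi : i + 1 < M) :
    κ i * s (i + 1) * s i = κ i * κ (i + 1) := by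
  have hi' : i < M := by omega
  have h1 : κ (i + 1) * (κ i * s (i + 1) * s i) = κ (i + 1) := by
    rw [mul_assoc, ← h.braid_kappa' hi, ← mul_assoc, ← mul_assoc, h.kappa_mul_sigma hi,
      smul_mul_assoc, smul_mul_assoc, h.tangle' hi, smul_smul, mul_inv_cancel₀ g.nu_ne, one_smul]
  have h2 := congrArg (κ i * ·) h1
  simp only [← mul_assoc, h.kappa_kappa_kappa g hi] at h2
  exact h2

lemma kappa_inv_inv {i : ℕ} (hi : i + 1 < M) :
    κ i * t (i + 1) * t i = κ i * κ (i + 1) := by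
  have hi' : i < M := by omega
  have h1 : κ (i + 1) * (κ i * t (i + 1) * t i) = κ (i + 1) := by
    rw [mul_assoc, ← h.braid_inv hi, ← mul_assoc, ← mul_assoc, h.kappa_mul_inv g hi,
      smul_mul_assoc, smul_mul_assoc, h.tangle_inv' hi, smul_smul, inv_mul_cancel₀ g.nu_ne, one_smul]
  have h2 := congrArg (κ i * ·) h1
  simp only [← mul_assoc, h.kappa_kappa_kappa g hi] at h2
  exact h2

lemma kappa_sigma_sigma' {i : ℕ} (hi : i + 1 < M) :
    κ (i + 1) * s i * s (i + 1) = κ (i + 1) * κ i := by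
  simpa using (h.mirror hi).kappa_sigma_sigma g (i := 0) (by norm_num)

lemma sigma_sigma_kappa {i : ℕ} (hi : i + 1 < M) :
    s (i + 1) * s i * κ (i + 1) = κ i * κ (i + 1) := by
  rw [h.braid_kappa' hi, ← mul_assoc, h.kappa_sigma_sigma g hi]

lemma sigma_sigma_kappa' {i : ℕ} (hi : i + 1 < M) :
    s i * s (i + 1) * κ i = κ (i + 1) * κ i := by
  rw [h.braid_kappa hi, ← mul_assoc, h.kappa_sigma_sigma' g hi]

lemma kappa_mul_sigma_prev {i : ℕ} (hi : i + 1 < M) :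
    κ (i + 1) * s i = κ (i + 1) * κ i * t (i + 1) := by
  rw [← h.kappa_sigma_sigma' g hi, mul_assoc, h.mul_inv _ hi, mul_one]

lemma inv_prev_mul_kappa {i : ℕ} (hi : i + 1 < M) :
    t i * κ (i + 1) = s (i + 1) * (κ i * κ (i + 1)) := by
  rw [← h.kappa_inv_inv g hi, mul_assoc (κ i), ← h.braid_inv hi, ← mul_assoc, ← mul_assoc,
    h.mul_inv _ hi, one_mul]

omit g in
lemma sigma_comm {i j : ℕ} (hi : i < M) (hj : j < M) (hij : i + 1 < j ∨ j + 1 < i) :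
    Commute (s i) (s j) := by
  rcases hij with hij | hij
  · exact h.locality i j hij hj
  · exact (h.locality j i hij hi).symm

omit g in
lemma sigma_comm_jm :
    ∀ {j : ℕ} (_ : j < M) (k : ℕ), k ≤ M → k ≠ j → k ≠ j + 1 → Commute (s j) (y k)
  | _, _, 0, _, _, _ => Commute.one_right _
  | j, hj, k + 1, hk, h1, h2 => by
    by_cases hkj : j + 1 < k
    · have := sigma_comm_jm hj k (by omega) (by omega) (by omega)
      have hs := h.sigma_comm hj (by omega : k < M) (Or.inl hkj)
      exact (hs.mul_right this).mul_right hs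
    · rcases lt_or_gt_of_ne h1 with h3 | h3
      · have := sigma_comm_jm hj k (by omega) (by omega) (by omega)
        have hs := h.sigma_comm hj (by omega : k < M) (Or.inr (by omega))
        exact (hs.mul_right this).mul_right hs
      -- This is `y (j + 2)`, the first Jucys-Murphy element containing `s (j + 1)`: here the braid
      -- relation is needed, once on each side of `y j`.
      · obtain rfl : k = j + 1 := by omega
        have hy : Commute (s (j + 1)) (y j) :=
          sigma_comm_jm (by omega) j (by omega) (by omega) (by omega)
        have hb := h.braid j (by omega)
        change s j * (s (j + 1) * (s j * y j * s j) * s (j + 1)) =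
          s (j + 1) * (s j * y j * s j) * s (j + 1) * s j
        calc _ = s j * s (j + 1) * s j * y j * s j * s (j + 1) := by simp only [mul_assoc]
          _ = s (j + 1) * s j * (s (j + 1) * y j) * s j * s (j + 1) := by
              rw [hb]; simp only [mul_assoc]
          _ = s (j + 1) * s j * y j * (s (j + 1) * s j * s (j + 1)) := by
              rw [hy.eq]; simp only [mul_assoc]
          _ = _ := by rw [← hb]; simp only [mul_assoc]

omit [Algebra ℂ A] g h in
lemma jm_comm_of_commute {x : A} (k : ℕ) (hx : ∀ j < k, Commute x (s j)) : Commute x (y k) := by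
  induction k with
  | zero => exact Commute.one_right _
  | succ k ih =>
    have := ih (fun j hj => hx j (by omega))
    exact ((hx k (by omega)).mul_right this).mul_right (hx k (by omega))

omit g in
lemma jm_comm {j k : ℕ} (hj : j ≤ M) (hk : k ≤ M) : Commute (y j) (y k) := by
  wlog hjk : j ≤ k generalizing j k
  · exact (this hk hj (by omega)).symm
  rcases eq_or_lt_of_le hjk with rfl | hjk
  · exact Commute.refl _
  · refine (jm_comm_of_commute (x := y k) j fun i hi => ?_).symm
    exact (h.sigma_comm_jm (by omega) k hk (by omega) (by omega)).symm

omit g in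
lemma kappa_comm_jm {j k : ℕ} (hj : j < M) (hk : k ≤ M) (h1 : k ≠ j) (h2 : k ≠ j + 1) :
    Commute (κ j) (y k) :=
  (commute_kappaOf (h.sigma_comm_jm hj k hk h1 h2).symm).symm

/-- Beside `κ i` the two neighbouring elements are inverse up to `ν ^ 2`. The induction moves `κ (i
+ 1)` to `κ (i + 1) * κ i`, where the previous identity applies, and back. -/
lemma kappa_jm_jm : ∀ {i : ℕ}, i < M → κ i * (y i * y (i + 1)) = (ν ^ 2) • κ i
  | 0, hi => by
    change κ 0 * (1 * (s 0 * 1 * s 0)) = _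
    rw [one_mul, mul_one, ← mul_assoc, h.kappa_mul_sigma hi, smul_mul_assoc, h.kappa_mul_sigma hi,
      smul_smul, sq]
  | i + 1, hi => by
    have hi' : i < M := by omega
    have ih := kappa_jm_jm (i := i) hi'
    have hy : Commute (s (i + 1)) (y i) :=
      h.sigma_comm_jm (by omega) i (by omega) (by omega) (by omega)
    -- The induction hypothesis with one factor `s i` absorbed into `κ i`, which costs a factor `ν`.
    have hk : κ i * (y i * s i * y i) = ν • κ i := by
      have e : ν • (κ i * (y i * s i * y i)) = ν ^ 2 • κ i := by
        rw [← ih, (h.jm_comm (by omega) (by omega) : Commute (y i) (y (i + 1))).eq]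
        change _ = κ i * (s i * y i * s i * y i)
        rw [← smul_mul_assoc, ← h.kappa_mul_sigma hi']
        simp only [mul_assoc]
      rw [sq, mul_smul] at e
      exact smul_right_injective A g.nu_ne e
    rw [(h.jm_comm (by omega) (by omega) : Commute (y (i + 1)) (y (i + 2))).eq]
    have hb := h.braid i hi
    calc _ = κ (i + 1) * s (i + 1) * (s i * y i * s i * s (i + 1) * (s i * y i * s i)) := by
            change κ (i + 1) * (s (i + 1) * (s i * y i * s i) * s (i + 1) * (s i * y i * s i)) = _
            simp only [mul_assoc]
      _ = ν • (κ (i + 1) * s i * y i * (s i * s (i + 1) * s i) * y i * s i) := by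
            rw [h.kappa_mul_sigma hi, smul_mul_assoc]; simp only [mul_assoc]
      _ = ν • (κ (i + 1) * s i * (y i * s (i + 1)) * s i * (s (i + 1) * y i) * s i) := by
            rw [hb]; simp only [mul_assoc]
      _ = ν • (κ (i + 1) * s i * s (i + 1) * (y i * s i * y i) * (s (i + 1) * s i)) := by
            simp only [mul_assoc, hy.left_comm]
      _ = ν • ν • (κ (i + 1) * (κ i * s (i + 1) * s i)) := by
            rw [h.kappa_sigma_sigma' g hi, mul_assoc (κ (i + 1)) (κ i), hk, mul_smul_comm,
              smul_mul_assoc]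
            simp only [mul_assoc]
      _ = _ := by
            rw [h.kappa_sigma_sigma g hi, ← mul_assoc, h.kappa_kappa_kappa' g hi, smul_smul, sq]

lemma jm_jm_kappa : ∀ {i : ℕ}, i < M → y i * y (i + 1) * κ i = (ν ^ 2) • κ i
  | 0, hi => by
    change 1 * (s 0 * 1 * s 0) * κ 0 = _
    rw [one_mul, mul_one, mul_assoc, h.sigma_mul_kappa hi, mul_smul_comm, h.sigma_mul_kappa hi,
      smul_smul, sq]
  | i + 1, hi => by
    have hi' : i < M := by omega
    have ih := jm_jm_kappa (i := i) hi'
    have hy : Commute (s (i + 1)) (y i) :=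
      h.sigma_comm_jm (by omega) i (by omega) (by omega) (by omega)
    have hk : y i * s i * y i * κ i = ν • κ i := by
      have e : ν • (y i * s i * y i * κ i) = ν ^ 2 • κ i := by
        rw [← ih]
        change _ = y i * (s i * y i * s i) * κ i
        rw [← mul_smul_comm, ← h.sigma_mul_kappa hi']
        simp only [mul_assoc]
      rw [sq, mul_smul] at e
      exact smul_right_injective A g.nu_ne e
    have hb := h.braid i hi
    calc _ = s i * y i * s i * (s (i + 1) * (s i * y i * s i)) * (s (i + 1) * κ (i + 1)) := by
            change s i * y i * s i * (s (i + 1) * (s i * y i * s i) * s (i + 1)) * κ (i + 1) = _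
            simp only [mul_assoc]
      _ = ν • (s i * y i * (s i * s (i + 1) * s i) * y i * (s i * κ (i + 1))) := by
            rw [h.sigma_mul_kappa hi, mul_smul_comm]; simp only [mul_assoc]
      _ = ν • (s i * (y i * s (i + 1)) * s i * (s (i + 1) * y i) * (s i * κ (i + 1))) := by
            rw [hb]; simp only [mul_assoc]
      _ = ν • (s i * s (i + 1) * (y i * s i * y i) * (s (i + 1) * s i * κ (i + 1))) := by
            simp only [mul_assoc, hy.left_comm]
      _ = ν • ν • (s i * s (i + 1) * κ i * κ (i + 1)) := by
            rw [h.sigma_sigma_kappa g hi, mul_assoc (s i * s (i + 1)), ← mul_assoc _ (κ i), hk,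
              smul_mul_assoc, mul_smul_comm]
            simp only [mul_assoc]
      _ = _ := by
            rw [h.sigma_sigma_kappa' g hi, h.kappa_kappa_kappa' g hi, smul_smul, sq]

omit g in
/-- The exchange relation between consecutive Jucys-Murphy elements. -/
lemma jm_succ_mul_inv {i : ℕ} (hi : i < M) : y (i + 1) * t i = s i * y i := by
  change s i * y i * s i * t i = _
  rw [mul_assoc, h.mul_inv i hi, mul_one]

omit g in
lemma inv_mul_jm_succ {i : ℕ} (hi : i < M) : t i * y (i + 1) = y i * s i := by
  change t i * (s i * y i * s i) = _
  rw [mul_assoc, ← mul_assoc, h.inv_mul i hi, one_mul]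

end BMWFamily
end Algebra

/-! ### Resolvents of the Jucys-Murphy elements -/

namespace BMWFamily

variable {q ν : ℂ} {M : ℕ}

section Resolvent

variable {A : Type*} [Ring A] [Algebra ℂ A] {s t : ℕ → A}

local notation:max "κ" i:max => kappaOf q ν (s i)
local notation:max "y" i:max => jucysMurphy s i

variable (g : GenericParams q ν) (h : BMWFamily q ν M s t)
include g h

omit [Algebra ℂ A] g h in
lemma commute_of_inverse {a b c : A} (hab : Commute a b) (h1 : c * b = 1) (h2 : b * c = 1) :
    Commute a c := by
  change a * c = c * a
  calc a * c = c * b * a * c := by rw [h1, one_mul]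
    _ = c * a * (b * c) := by rw [mul_assoc c, ← hab.eq]; simp only [mul_assoc]
    _ = c * a := by rw [h2, mul_one]

/-- The exchange relation `y (i + 1) * t i = s i * y i`, with the skein relation for `t i`, compares
`s i * (w • 1 - y i)` with `(w • 1 - y (i + 1)) * s i`; sandwich it between the resolvents. The
inverse `T` enters because `y i * y (i + 1) * κ i = ν ^ 2 • κ i` turns `R' * y (i + 1) * κ i` into
`ν ^ 2 • (T * κ i)`. -/
lemma resolvent_mul_sigma {i : ℕ} (hi : i < M) {w : ℂ} {R R' T : A}
    (hR : (w • 1 - y i) * R = 1)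
    (hR' : R' * (w • 1 - y (i + 1)) = 1) (hR'2 : (w • 1 - y (i + 1)) * R' = 1)
    (hT : T * (w • y i - ν ^ 2 • 1) = 1) :
    R' * s i = s i * R + (q - q⁻¹) • (R' * y (i + 1) * R)
      - ((q - q⁻¹) * ν ^ 2) • (T * κ i * R) := by
  have hyy : Commute (y i) (y (i + 1)) := h.jm_comm (by omega) (by omega)
  have hyR' : Commute (y i) R' :=
    commute_of_inverse (((Commute.one_right _).smul_right _).sub_right hyy) hR' hR'2
  have e1 : R' * y (i + 1) * κ i = ν ^ 2 • (T * κ i) := by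
    have e2 : (w • y i - ν ^ 2 • 1) * (R' * y (i + 1) * κ i) = ν ^ 2 • κ i := by
      have e3 := h.jm_jm_kappa g hi
      have : (w • y i - ν ^ 2 • 1) * (R' * y (i + 1) * κ i) =
          R' * (w • 1 - y (i + 1)) * (ν ^ 2 • κ i) := by
        rw [← e3, sub_mul, smul_mul_assoc, smul_mul_assoc, one_mul, mul_sub, sub_mul,
          mul_smul_comm, mul_one, ← mul_assoc, ← mul_assoc, hyR'.eq, e3, mul_smul_comm (ν ^ 2),
          smul_mul_assoc, mul_assoc R' (y i), mul_assoc R', e3]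
        rw [mul_smul_comm, smul_comm, mul_smul_comm (ν ^ 2)]
      rw [this, hR', one_mul]
    have := congrArg (T * ·) e2
    simp only [← mul_assoc, hT, one_mul, mul_smul_comm] at this
    exact this
  have e4 := h.jm_succ_mul_inv hi
  rw [h.inv_eq g hi, mul_add, mul_sub, mul_smul_comm, mul_smul_comm, mul_one] at e4
  have e5 : s i * (w • 1 - y i) = (w • 1 - y (i + 1)) * s i + (q - q⁻¹) • y (i + 1)
      - (q - q⁻¹) • (y (i + 1) * κ i) := by
    rw [mul_sub, ← e4, sub_mul, mul_smul_comm, smul_mul_assoc, mul_one, one_mul]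
    abel
  have e6 : R' * s i = R' * (s i * (w • 1 - y i)) * R := by
    rw [mul_assoc, mul_assoc, hR, mul_one]
  rw [e6, e5, mul_sub, mul_add, sub_mul, add_mul, ← mul_assoc R', hR', one_mul, mul_smul_comm,
    mul_smul_comm, smul_mul_assoc, smul_mul_assoc, ← mul_assoc, e1, smul_mul_assoc, smul_smul]

lemma kappa_mul_resolvent {i : ℕ} (hi : i < M) {w : ℂ} {R' T : A}
    (hR' : R' * (w • 1 - y (i + 1)) = 1) (hR'2 : (w • 1 - y (i + 1)) * R' = 1)
    (hT : (w • y i - ν ^ 2 • 1) * T = 1) : κ i * R' = κ i * y i * T := by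
  have hyy : Commute (y i) (y (i + 1)) := h.jm_comm (by omega) (by omega)
  have hyR' : Commute (y i) R' :=
    commute_of_inverse (((Commute.one_right _).smul_right _).sub_right hyy) hR' hR'2
  have e1 : κ i * (w • y i - ν ^ 2 • 1) = κ i * y i * (w • 1 - y (i + 1)) := by
    rw [mul_sub, mul_sub, mul_smul_comm, mul_smul_comm, mul_smul_comm, mul_one, mul_one, mul_assoc,
      h.kappa_jm_jm g hi]
  calc κ i * R' = κ i * (R' * (w • y i - ν ^ 2 • 1)) * T := by
        rw [mul_assoc, mul_assoc, hT, mul_one]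
    _ = κ i * ((w • y i - ν ^ 2 • 1) * R') * T := by
        rw [((hyR'.symm.smul_right w).sub_right ((Commute.one_right R').smul_right _)).eq]
    _ = _ := by rw [← mul_assoc, e1, mul_assoc _ _ R', hR'2, mul_one]

lemma kappa_mul_resolvent_mul_sigma {i : ℕ} (hi : i < M) {w : ℂ} {R R' T : A}
    (hR : (w • 1 - y i) * R = 1) (hR2 : R * (w • 1 - y i) = 1)
    (hR' : R' * (w • 1 - y (i + 1)) = 1) (hR'2 : (w • 1 - y (i + 1)) * R' = 1)
    (hT : (w • y i - ν ^ 2 • 1) * T = 1) (hT2 : T * (w • y i - ν ^ 2 • 1) = 1) :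
    κ i * R * s i = ν • (κ i * y i * T) - ((q - q⁻¹) * ν ^ 2) • (κ i * T * R)
      + ((q - q⁻¹) * ν ^ 2) • (κ i * R * κ i * T) := by
  have hyy : Commute (y i) (y (i + 1)) := h.jm_comm (by omega) (by omega)
  have hyR : Commute (y (i + 1)) R :=
    commute_of_inverse (((Commute.one_right _).smul_right _).sub_right hyy.symm) hR2 hR
  have hRR' : Commute R R' := commute_of_inverse
    (((Commute.one_right _).smul_right _).sub_right hyR.symm) hR' hR'2
  have e1 : κ i * (y (i + 1) * R') = ν ^ 2 • (κ i * T) := by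
    have e0 := h.kappa_mul_resolvent g hi hR' hR'2 hT
    have e2 : y (i + 1) * R' = R' * y (i + 1) :=
      commute_of_inverse (((Commute.one_right _).smul_right _).sub_right (Commute.refl _)) hR' hR'2
    have e3 : Commute (y (i + 1)) T := commute_of_inverse
      ((hyy.symm.smul_right _).sub_right ((Commute.one_right _).smul_right _)) hT2 hT
    rw [e2, ← mul_assoc, e0, mul_assoc, ← e3.eq, ← mul_assoc, mul_assoc (κ i), h.kappa_jm_jm g hi,
      smul_mul_assoc]
  have e4 := h.inv_mul_jm_succ hi
  rw [h.inv_eq g hi, add_mul, sub_mul, smul_mul_assoc, smul_mul_assoc, one_mul] at e4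
  have e5 : s i * (w • 1 - y (i + 1)) = (w • 1 - y i) * s i - (q - q⁻¹) • y (i + 1)
      + (q - q⁻¹) • (κ i * y (i + 1)) := by
    rw [sub_mul, ← e4, mul_sub, mul_smul_comm, smul_mul_assoc, mul_one, one_mul]
    abel
  have e6 : R * s i = s i * R' - (q - q⁻¹) • (R * (y (i + 1) * R'))
      + (q - q⁻¹) • (R * (κ i * (y (i + 1) * R'))) := by
    calc R * s i = R * (s i * (w • 1 - y (i + 1))) * R' := by
          rw [mul_assoc, mul_assoc, hR'2, mul_one]
      _ = _ := by
          rw [e5, mul_add, mul_sub, add_mul, sub_mul, ← mul_assoc R, hR2, one_mul, mul_smul_comm,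
            mul_smul_comm, smul_mul_assoc, smul_mul_assoc]
          simp only [mul_assoc]
  have e7 : R * (y (i + 1) * R') = y (i + 1) * R' * R := by
    rw [← mul_assoc, ← hyR.eq, mul_assoc, hRR'.eq, mul_assoc]
  rw [mul_assoc, e6, mul_add, mul_sub, ← mul_assoc, h.kappa_mul_sigma hi, smul_mul_assoc,
    h.kappa_mul_resolvent g hi hR' hR'2 hT, mul_smul_comm, e7, ← mul_assoc (κ i) (_ * R') R, e1,
    mul_smul_comm, mul_smul_comm, mul_smul_comm, smul_mul_assoc, smul_smul, smul_smul]
  simp only [mul_assoc]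

end Resolvent

section Module

variable {V : Type*} [AddCommGroup V] [Module ℂ V] {s t : ℕ → Module.End ℂ V}

local notation:max "κ" i:max => kappaOf q ν (s i)
local notation:max "y" i:max => jucysMurphy s i

variable (g : GenericParams q ν) (h : BMWFamily q ν M s t)
include g h

/-- The recursion behind the generating function. Insert `s i * t i = 1` after `R'` and push `R'`
through `s i`: one term reproduces the known scalar `z`, another returns `κ (i + 1)` applied to `R'
(s i x)`, which again contains the unknown vector. Solving this linear equation produces the
quadratic factor on the left. -/
lemma kappa_resolvent_kappa_step {i : ℕ} (hi : i + 1 < M) {w a z : ℂ} {R R' T : Module.End ℂ V}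
    (hR : (w • 1 - y i) * R = 1) (hR2 : R * (w • 1 - y i) = 1)
    (hR' : R' * (w • 1 - y (i + 1)) = 1) (hR'2 : (w • 1 - y (i + 1)) * R' = 1)
    (hT : (w • y i - ν ^ 2 • 1) * T = 1) (hT2 : T * (w • y i - ν ^ 2 • 1) = 1)
    (hwa : w - a ≠ 0) (hwa' : w * a - ν ^ 2 ≠ 0) {u : V} (hu : y i u = a • u)
    (hz : κ i (R (κ i (κ (i + 1) u))) = z • κ i (κ (i + 1) u)) :
    ((w - a) ^ 2 - (q - q⁻¹) ^ 2 * w * a) • κ (i + 1) (R' (κ (i + 1) u)) =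
      ((w - a) ^ 2 * z + (q - q⁻¹) * a * (ν - (q - q⁻¹) - (q - q⁻¹) * ν ^ 2 * (w * a - ν ^ 2)⁻¹)
        - (w - a) ^ 2 * ((q - q⁻¹) * ν ^ 2 * (w * a - ν ^ 2)⁻¹ *
          (ν * a * (w * a - ν ^ 2)⁻¹ - (q - q⁻¹) * ν ^ 2 * (w * a - ν ^ 2)⁻¹ * (w - a)⁻¹
            + (q - q⁻¹) * ν ^ 2 * z * (w * a - ν ^ 2)⁻¹ - (q - q⁻¹) * (w - a)⁻¹
            + (q - q⁻¹) * z))) • κ (i + 1) u := by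
  have hi' : i < M := by omega
  have hyy : Commute (y i) (y (i + 1)) := h.jm_comm (by omega) (by omega)
  have hyR' : Commute (y i) R' :=
    commute_of_inverse (((Commute.one_right _).smul_right _).sub_right hyy) hR' hR'2
  have hyk : Commute (y i) (κ (i + 1)) :=
    (h.kappa_comm_jm hi (by omega) (by omega) (by omega)).symm
  have hys : Commute (y i) (s (i + 1)) :=
    (h.sigma_comm_jm hi i (by omega) (by omega) (by omega)).symm
  have hkR : Commute (κ (i + 1)) R := commute_of_inverse
    (((Commute.one_right _).smul_right _).sub_right hyk.symm) hR2 hR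
  have hsR : Commute (s (i + 1)) R := commute_of_inverse
    (((Commute.one_right _).smul_right _).sub_right hys.symm) hR2 hR
  have hkT : Commute (κ (i + 1)) T := commute_of_inverse
    ((hyk.symm.smul_right _).sub_right ((Commute.one_right _).smul_right _)) hT2 hT
  have hRR' : Commute R R' := commute_of_inverse (((Commute.one_right _).smul_right _).sub_right
    (commute_of_inverse (((Commute.one_right _).smul_right _).sub_right hyy.symm) hR2 hR).symm)
    hR' hR'2
  have hRy' : Commute R (y (i + 1)) :=
    (commute_of_inverse (((Commute.one_right _).smul_right _).sub_right hyy.symm) hR2 hR).symm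
  have ap : ∀ {P Q : Module.End ℂ V}, P = Q → ∀ v, P v = Q v := fun e v => by rw [e]
  have eigR : ∀ v : V, y i v = a • v → R v = (w - a)⁻¹ • v := by
    intro v hv
    have := ap hR2 v
    simp only [Module.End.mul_apply, LinearMap.sub_apply, LinearMap.smul_apply,
      Module.End.one_apply, hv, ← sub_smul, map_smul] at this
    rw [eq_inv_smul_iff₀ hwa, this]
  have eigT : ∀ v : V, y i v = a • v → T v = (w * a - ν ^ 2)⁻¹ • v := by
    intro v hv
    have := ap hT2 v
    simp only [Module.End.mul_apply, LinearMap.sub_apply, LinearMap.smul_apply,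
      Module.End.one_apply, hv, smul_smul, ← sub_smul, map_smul] at this
    rw [eq_inv_smul_iff₀ hwa', this]
  set x := κ (i + 1) u with hxdef
  set X := κ (i + 1) (R' x) with hXdef
  have hx : y i x = a • x := by
    rw [hxdef, ← Module.End.mul_apply, hyk.eq, Module.End.mul_apply, hu, map_smul]
  have hX : y i X = a • X := by
    rw [hXdef, ← Module.End.mul_apply, hyk.eq, Module.End.mul_apply, ← Module.End.mul_apply (y i),
      hyR'.eq, Module.End.mul_apply, hx, map_smul, map_smul]
  have hkx : κ (i + 1) x = loopParam q ν • x := by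
    rw [hxdef, ← Module.End.mul_apply, h.kappa_sq g hi, LinearMap.smul_apply]
  have hkkx : κ (i + 1) (κ i x) = x := by
    have := ap (h.kappa_kappa_kappa' g hi) u
    simpa only [Module.End.mul_apply] using this
  have hksx : κ (i + 1) (s i x) = ν⁻¹ • x := by
    have := ap (h.tangle' hi) u
    simpa only [Module.End.mul_apply, LinearMap.smul_apply] using this
  have htx : t i x = s (i + 1) (κ i x) := by
    have := ap (h.inv_prev_mul_kappa g hi) u
    simpa only [Module.End.mul_apply] using this
  set r := (w - a)⁻¹ with hr
  set τ := (w * a - ν ^ 2)⁻¹ with hτ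
  set d := q - q⁻¹ with hd
  have hr1 : (w - a) * r = 1 := mul_inv_cancel₀ hwa
  have hRx := eigR x hx
  have hTx := eigT x hx
  have hRX := eigR X hX
  have hy'R' : κ (i + 1) (R' (y (i + 1) x)) = w • X - loopParam q ν • x := by
    have := ap hR' x
    simp only [Module.End.mul_apply, LinearMap.sub_apply, LinearMap.smul_apply,
      Module.End.one_apply, map_sub, map_smul] at this
    have h2 := LinearMap.congr_arg (f := κ (i + 1)) this
    rw [map_sub, map_smul, hkx] at h2
    rw [← h2]; abel
  have hA : κ (i + 1) (R' (s i x)) =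
      r • (ν⁻¹ • x + d • (w • X - loopParam q ν • x) - (d * ν ^ 2 * τ) • x) := by
    have h1 := LinearMap.congr_arg (f := κ (i + 1)) (ap (h.resolvent_mul_sigma g hi' hR hR' hR'2 hT2) x)
    simp only [Module.End.mul_apply, LinearMap.sub_apply, LinearMap.add_apply,
      LinearMap.smul_apply, map_sub, map_add, map_smul, hRx, hksx, hy'R'] at h1
    have h2 : κ (i + 1) (T (κ i x)) = τ • x := by
      rw [← Module.End.mul_apply, hkT.eq, Module.End.mul_apply, hkkx, hTx]
    rw [h1, h2]
    module
  have hkRt : κ i (R (t i x)) = (ν * a * τ - d * ν ^ 2 * τ * r + d * ν ^ 2 * z * τ - d * r + d * z)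
      • κ i x := by
    have h1 := ap (h.kappa_mul_resolvent_mul_sigma g hi' hR hR2 hR' hR'2 hT hT2) x
    simp only [Module.End.mul_apply, LinearMap.sub_apply, LinearMap.add_apply,
      LinearMap.smul_apply, map_smul, hRx, hTx, hx, hz] at h1
    rw [h.inv_eq g hi']
    simp only [LinearMap.sub_apply, LinearMap.add_apply, LinearMap.smul_apply, map_sub, map_add,
      map_smul, Module.End.one_apply, h1, hRx, hz]
    module
  have hmain : X = z • x + (d * a * r) • κ (i + 1) (R' (s i x))
      - (d * ν ^ 2 * τ * (ν * a * τ - d * ν ^ 2 * τ * r + d * ν ^ 2 * z * τ - d * r + d * z)) • x := by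
    have h0 : X = κ (i + 1) (R' (s i (t i x))) := by
      rw [← Module.End.mul_apply (s i), h.mul_inv i hi', Module.End.one_apply]
    have h1 := LinearMap.congr_arg (f := κ (i + 1)) (ap (h.resolvent_mul_sigma g hi' hR hR' hR'2 hT2) (t i x))
    simp only [Module.End.mul_apply, LinearMap.sub_apply, LinearMap.add_apply,
      LinearMap.smul_apply, map_sub, map_add, map_smul] at h1
    -- `t i x = s (i + 1) (κ i x)`, and `s (i + 1)` commutes with `R`; then `κ (i + 1) * s i * s (i
    -- + 1) = κ (i + 1) * κ i` exposes the compression that defines `z`.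
    have p1 : κ (i + 1) (s i (R (t i x))) = z • x := by
      rw [htx, ← Module.End.mul_apply R, ← hsR.eq, Module.End.mul_apply,
        ← Module.End.mul_apply (κ (i + 1)), h.kappa_mul_sigma_prev g hi, Module.End.mul_apply,
        Module.End.mul_apply, ← Module.End.mul_apply (t (i + 1)), h.inv_mul _ hi,
        Module.End.one_apply, hz, map_smul, hkkx]
    have p2 : κ (i + 1) (R' (y (i + 1) (R (t i x)))) = (a * r) • κ (i + 1) (R' (s i x)) := by
      rw [← Module.End.mul_apply (y (i + 1)), ← hRy'.eq, Module.End.mul_apply,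
        ← Module.End.mul_apply R', ← hRR'.eq, Module.End.mul_apply,
        ← Module.End.mul_apply (κ (i + 1)), hkR.eq, Module.End.mul_apply,
        ← Module.End.mul_apply (y (i + 1)), h.jm_succ_mul_inv hi', Module.End.mul_apply, hx,
        map_smul, map_smul, map_smul, map_smul, mul_smul]
      congr 1
      rw [hA]
      simp only [map_smul, map_add, map_sub, hRx, hRX]
      module
    have p3 : κ (i + 1) (T (κ i (R (t i x)))) = (τ *
        (ν * a * τ - d * ν ^ 2 * τ * r + d * ν ^ 2 * z * τ - d * r + d * z)) • x := by
      rw [hkRt, map_smul, map_smul, ← Module.End.mul_apply, hkT.eq, Module.End.mul_apply, hkkx, hTx]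
      module
    rw [h0, h1, p1, p2, p3]
    module
  have hmu := g.delta_mul_loopParam
  rw [← hd] at hmu
  rw [hA] at hmain
  generalize ν * a * τ - d * ν ^ 2 * τ * r + d * ν ^ 2 * z * τ - d * r + d * z = G at *
  have hfin : ((w - a) ^ 2) • X = ((w - a) ^ 2) • (z • x + (d * a * r) • r •
      (ν⁻¹ • x + d • (w • X - loopParam q ν • x) - (d * ν ^ 2 * τ) • x) - (d * ν ^ 2 * τ * G) • x) := by
    rw [← hmain]
  have hr2 : (w - a) ^ 2 * (r * r) = 1 := by linear_combination ((w - a) * r + 1) * hr1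
  have e3 : ((w - a) ^ 2) • X = ((w - a) ^ 2 * z) • x + (((w - a) ^ 2 * (r * r)) * (d * a)) •
      ((ν⁻¹ - d * loopParam q ν - d * ν ^ 2 * τ) • x + (d * w) • X) -
        ((w - a) ^ 2 * (d * ν ^ 2 * τ * G)) • x := by
    rw [hfin]; module
  rw [hr2, hmu] at e3
  rw [sub_smul, e3]
  module

end Module
end BMWFamily

section

open Polynomial Filter

/-! ### Contents, shapes and paths -/

/-- The content of the letter that moves along the edge `{l, l + 1}`: `b = true` adds a box of
content `l`, `b = false` removes it. -/
noncomputable def letterContent (q ν : ℂ) (l : ℤ) (b : Bool) : ℂ :=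
  if b then q ^ (2 * l) else ν ^ 2 * q ^ (-(2 * l))

namespace GenericParams

variable {q ν : ℂ} (g : GenericParams q ν)
include g

lemma content_ne_zero (l : ℤ) (b : Bool) : letterContent q ν l b ≠ 0 := by
  have h1 := zpow_ne_zero (2 * l) g.q_ne
  have h2 := zpow_ne_zero (-(2 * l)) g.q_ne
  have h3 := g.nu_ne
  cases b <;> simp only [letterContent, Bool.false_eq_true, ↓reduceIte] <;> positivity

/-- Within one kind this is injectivity of the powers of `q`; across kinds a coincidence would make
`ν ^ 2` an even power of `q`. -/
lemma content_inj {l l' : ℤ} {b b' : Bool} (h : letterContent q ν l b = letterContent q ν l' b') :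
    l = l' ∧ b = b' := by
  have hν : ν ^ 2 ≠ 0 := pow_ne_zero 2 g.nu_ne
  have key : ∀ k k' : ℤ, q ^ (2 * k) ≠ ν ^ 2 * q ^ (-(2 * k')) := by
    intro k k' h
    apply g.nu_sq_ne (k + k')
    rw [mul_add, zpow_add₀ g.q_ne, h, mul_assoc, ← zpow_add₀ g.q_ne]
    simp
  cases b <;> cases b' <;> simp only [letterContent, Bool.false_eq_true, ↓reduceIte] at h
  · have := g.zpow_injective (mul_left_cancel₀ hν h)
    exact ⟨by omega, rfl⟩
  · exact absurd h.symm (key _ _)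
  · exact absurd h (key _ _)
  · have := g.zpow_injective h
    exact ⟨by omega, rfl⟩

lemma content_eq_iff {l l' : ℤ} {b b' : Bool} :
    letterContent q ν l b = letterContent q ν l' b' ↔ l = l' ∧ b = b' :=
  ⟨g.content_inj, fun ⟨h1, h2⟩ => by rw [h1, h2]⟩

lemma content_mul_not (l : ℤ) (b : Bool) : letterContent q ν l b * letterContent q ν l (!b) = ν ^ 2 := by
  have h1 := zpow_ne_zero (2 * l) g.q_ne
  cases b <;> simp only [letterContent, Bool.false_eq_true, ↓reduceIte, Bool.not_false, Bool.not_true,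
    zpow_neg] <;> field_simp

lemma eq_content_not {l : ℤ} {b : Bool} {c : ℂ} (h : letterContent q ν l b * c = ν ^ 2) :
    c = letterContent q ν l (!b) :=
  mul_left_cancel₀ (g.content_ne_zero l b) (h.trans (g.content_mul_not l b).symm)

lemma content_mul_eq_iff {l l' : ℤ} {b b' : Bool} :
    letterContent q ν l b * letterContent q ν l' b' = ν ^ 2 ↔ l' = l ∧ b' = !b :=
  ⟨fun h => g.content_inj (g.eq_content_not h), fun ⟨h1, h2⟩ => by
    rw [h1, h2, g.content_mul_not]⟩

lemma content_add_one (l : ℤ) (b : Bool) :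
    letterContent q ν (l + 1) b = (if b then q ^ 2 else (q ^ 2)⁻¹) * letterContent q ν l b := by
  have h := g.q_ne
  have e : q ^ 2 = q ^ (2 : ℤ) := by norm_cast
  cases b <;> simp only [letterContent, Bool.false_eq_true, ↓reduceIte, e, ← zpow_neg]
  · rw [mul_left_comm, ← zpow_add₀ h]; ring_nf
  · rw [← zpow_add₀ h]; ring_nf

lemma content_sub_one (l : ℤ) (b : Bool) :
    letterContent q ν (l - 1) b = (if b then (q ^ 2)⁻¹ else q ^ 2) * letterContent q ν l b := by
  have h := pow_ne_zero 2 g.q_ne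
  have := g.content_add_one (l - 1) b
  rw [sub_add_cancel] at this
  rw [this]
  cases b <;> simp [h]

lemma q_sq_mul_content (l : ℤ) (b : Bool) :
    q ^ 2 * letterContent q ν l b = letterContent q ν (if b then l + 1 else l - 1) b := by
  cases b
  · simp [g.content_sub_one]
  · simp [g.content_add_one]

lemma q_sq_inv_mul_content (l : ℤ) (b : Bool) :
    (q ^ 2)⁻¹ * letterContent q ν l b = letterContent q ν (if b then l - 1 else l + 1) b := by
  cases b
  · simp [g.content_add_one]
  · simp [g.content_sub_one]

end GenericParams

/-- The Maya diagram of the empty partition. -/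
def emptyShape : ℤ → Bool := fun k => decide (k ≤ 0)

/-- Moving along the edge `{l, l + 1}`. -/
def stepShape (χ : ℤ → Bool) (l : ℤ) : ℤ → Bool := χ ∘ Equiv.swap l (l + 1)

/-- The letter `(l, b)` can be applied to the shape `χ`. -/
def Allowed (χ : ℤ → Bool) (l : ℤ) (b : Bool) : Prop := χ l = b ∧ χ (l + 1) = !b

/-- The first `m` entries of `a` are the contents of a path from the empty shape to `χ`. -/
def IsPath (q ν : ℂ) (a : ℕ → ℂ) : ℕ → (ℤ → Bool) → Prop
  | 0, χ => χ = emptyShape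
  | m + 1, χ => ∃ χ' l b, IsPath q ν a m χ' ∧ Allowed χ' l b ∧ a m = letterContent q ν l b ∧
      χ = stepShape χ' l

lemma stepShape_stepShape (χ : ℤ → Bool) (l : ℤ) : stepShape (stepShape χ l) l = χ := by
  funext k; simp [stepShape]

lemma stepShape_left (χ : ℤ → Bool) (l : ℤ) : stepShape χ l l = χ (l + 1) := by
  simp [stepShape]

lemma stepShape_right (χ : ℤ → Bool) (l : ℤ) : stepShape χ l (l + 1) = χ l := by
  simp [stepShape]

lemma stepShape_of_ne (χ : ℤ → Bool) {l k : ℤ} (h1 : k ≠ l) (h2 : k ≠ l + 1) :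
    stepShape χ l k = χ k := by
  simp [stepShape, Equiv.swap_apply_of_ne_of_ne h1 h2]

lemma Allowed.step_not {χ : ℤ → Bool} {l : ℤ} {b : Bool} (h : Allowed χ l b) :
    Allowed (stepShape χ l) l (!b) :=
  ⟨by rw [stepShape_left, h.2], by rw [stepShape_right, h.1, Bool.not_not]⟩

lemma IsPath.congr {q ν : ℂ} {a a' : ℕ → ℂ} : ∀ {m : ℕ} {χ : ℤ → Bool},
    (∀ j < m, a j = a' j) → IsPath q ν a m χ → IsPath q ν a' m χ
  | 0, _, _, h => h
  | m + 1, _, hj, ⟨χ', l, b, h1, h2, h3, h4⟩ =>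
    ⟨χ', l, b, h1.congr fun j hjm => hj j (by omega), h2, by rw [← hj m (by omega), h3], h4⟩

/-- Contents determine letters, so one may speak of the shape reached by a string. -/
lemma IsPath.unique {q ν : ℂ} (g : GenericParams q ν) {a : ℕ → ℂ} : ∀ {m : ℕ} {χ χ' : ℤ → Bool},
    IsPath q ν a m χ → IsPath q ν a m χ' → χ = χ'
  | 0, _, _, h, h' => h.trans h'.symm
  | m + 1, _, _, ⟨χ₁, l, b, h1, _, h3, h4⟩, ⟨χ₂, l', b', h1', _, h3', h4'⟩ => by
    rw [h4, h4', IsPath.unique g h1 h1', (g.content_inj (h3.symm.trans h3')).1]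

/-! ### Orders of rational functions -/

/-- Away from finitely many points, `F` is a rational function of order `n` at `c`. -/
def HasOrderAt (F : ℂ → ℂ) (c : ℂ) (n : ℤ) : Prop :=
  ∃ P Q : ℂ[X], P.eval c ≠ 0 ∧ Q.eval c ≠ 0 ∧
    ∀ᶠ w in cofinite, F w = (w - c) ^ n * (P.eval w / Q.eval w)

lemma HasOrderAt.mul {F G : ℂ → ℂ} {c : ℂ} {n m : ℤ} (hF : HasOrderAt F c n)
    (hG : HasOrderAt G c m) : HasOrderAt (fun w => F w * G w) c (n + m) := by
  obtain ⟨P, Q, hP, hQ, h⟩ := hF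
  obtain ⟨P', Q', hP', hQ', h'⟩ := hG
  refine ⟨P * P', Q * Q', by simp [hP, hP'], by simp [hQ, hQ'], ?_⟩
  filter_upwards [h, h', eventually_cofinite_ne c] with w h1 h2 hw
  rw [h1, h2, zpow_add₀ (sub_ne_zero.mpr hw), eval_mul, eval_mul, mul_div_mul_comm]
  ring

lemma HasOrderAt.inv {F : ℂ → ℂ} {c : ℂ} {n : ℤ} (hF : HasOrderAt F c n) :
    HasOrderAt (fun w => (F w)⁻¹) c (-n) := by
  obtain ⟨P, Q, hP, hQ, h⟩ := hF
  refine ⟨Q, P, hQ, hP, ?_⟩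
  filter_upwards [h] with w h1
  rw [h1, mul_inv, inv_div, zpow_neg]

lemma HasOrderAt.congr_order {F : ℂ → ℂ} {c : ℂ} {n m : ℤ} (hF : HasOrderAt F c n) (h : n = m) :
    HasOrderAt F c m := h ▸ hF

lemma HasOrderAt.div {F G : ℂ → ℂ} {c : ℂ} {n m : ℤ} (hF : HasOrderAt F c n)
    (hG : HasOrderAt G c m) : HasOrderAt (fun w => F w / G w) c (n - m) := by
  simpa only [div_eq_mul_inv, sub_eq_add_neg] using hF.mul hG.inv

lemma hasOrderAt_linear {c d e : ℂ} (he : e ≠ 0) [Decidable (d = c)] :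
    HasOrderAt (fun w => e * (d - w)) c (if d = c then 1 else 0) := by
  split_ifs with h
  · subst h
    refine ⟨C (-e), 1, by simp [he], by simp, Eventually.of_forall fun w => ?_⟩
    simp; ring
  · refine ⟨C e * (C d - X), 1, by simp [he, sub_ne_zero, h], by simp, Eventually.of_forall fun w => ?_⟩
    simp

lemma hasOrderAt_const {c e : ℂ} (he : e ≠ 0) : HasOrderAt (fun _ => e) c 0 :=
  ⟨C e, 1, by simp [he], by simp, Eventually.of_forall fun w => by simp⟩

/-- The indicator of a Boolean as an integer. -/
def boolInd (b : Bool) : ℤ := if b then 1 else 0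

/-- The sign attached to the two kinds of letters. -/
def boolSign (b : Bool) : ℤ := if b then 1 else -1

/-- The difference `χ k - χ (k + 1)` of indicators. -/
def descent (χ : ℤ → Bool) (k : ℤ) : ℤ := boolInd (χ k) - boolInd (χ (k + 1))

lemma descent_of_allowed {χ : ℤ → Bool} {l : ℤ} {b : Bool} (h : Allowed χ l b) :
    descent χ l = boolSign b := by
  unfold descent
  rw [h.1, h.2]
  cases b <;> rfl

/-- A step adds a signed second difference centred at `l`. This matches the orders of `stepFactor`
and yields the invariants used in the counting. -/
lemma descent_step {χ : ℤ → Bool} {l : ℤ} {b : Bool} (h : Allowed χ l b) (k : ℤ) :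
    descent (stepShape χ l) k = descent χ k + boolSign b *
      ((if l - 1 = k then 1 else 0) + (if l + 1 = k then 1 else 0) - 2 * (if l = k then 1 else 0)) := by
  obtain ⟨h1, h2⟩ := h
  have hb : boolInd (!b) = boolInd b - boolSign b := by cases b <;> rfl
  unfold descent
  by_cases e1 : k = l
  · subst e1
    rw [stepShape_left, stepShape_right, h1, h2, hb]
    simp; ring
  by_cases e2 : k = l + 1
  · subst e2
    rw [stepShape_right, stepShape_of_ne _ (by omega) (by omega), h1, h2, hb]
    simp only [show l - 1 ≠ l + 1 by omega, show l ≠ l + 1 by omega, if_false, if_true]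
    ring
  by_cases e3 : k = l - 1
  · subst e3
    rw [stepShape_of_ne _ (by omega) (by omega), sub_add_cancel, stepShape_left, h1, h2, hb]
    simp only [show l + 1 ≠ l - 1 by omega, show l ≠ l - 1 by omega, if_false, if_true]
    ring
  rw [stepShape_of_ne _ e1 e2, stepShape_of_ne _ (by omega) (by omega)]
  simp only [Ne.symm e1, Ne.symm e2, Ne.symm e3, if_false]
  ring

/-- The factor by which the generating function of `κ_i y_i ^ k κ_i` changes in one step. -/
noncomputable def stepFactor (q ν : ℂ) (l : ℤ) (b : Bool) (w : ℂ) : ℂ :=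
  (ν ^ 2 - letterContent q ν (l + 1) b * w) * (ν ^ 2 - letterContent q ν (l - 1) b * w) *
      (letterContent q ν l b - w) ^ 2 /
    ((letterContent q ν (l + 1) b - w) * (letterContent q ν (l - 1) b - w) *
      (ν ^ 2 - letterContent q ν l b * w) ^ 2)

/-- By `content_mul_not`, a factor `ν ^ 2 - c * w` vanishes at the content of the letter opposite to
`c`. Hence numerator and denominator give opposite orders at the two letters of an edge, and the
order is minus `boolSign b'` times the change of descent in `descent_step`. -/
lemma hasOrderAt_stepFactor {q ν : ℂ} (g : GenericParams q ν) (l : ℤ) (b : Bool) (k : ℤ) (b' : Bool) :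
    HasOrderAt (stepFactor q ν l b) (letterContent q ν k b') (-(boolSign b' * boolSign b *
      ((if l - 1 = k then 1 else 0) + (if l + 1 = k then 1 else 0)
        - 2 * (if l = k then 1 else 0)))) := by
  classical
  have h1 : ∀ (m : ℤ), HasOrderAt (fun w => letterContent q ν m b - w) (letterContent q ν k b')
      (if m = k ∧ b = b' then 1 else 0) := by
    intro m
    have := hasOrderAt_linear (c := letterContent q ν k b') (d := letterContent q ν m b) one_ne_zero
    simp only [one_mul, g.content_eq_iff] at this
    exact this
  have h2 : ∀ (m : ℤ), HasOrderAt (fun w => ν ^ 2 - letterContent q ν m b * w) (letterContent q ν k b')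
      (if m = k ∧ (!b) = b' then 1 else 0) := by
    intro m
    have := hasOrderAt_linear (c := letterContent q ν k b') (d := letterContent q ν m (!b))
      (g.content_ne_zero m b)
    simp only [mul_sub, g.content_mul_not, g.content_eq_iff] at this
    exact this
  have := (((h2 (l + 1)).mul (h2 (l - 1))).mul ((h1 l).mul (h1 l))).div
    (((h1 (l + 1)).mul (h1 (l - 1))).mul ((h2 l).mul (h2 l)))
  simp only [← sq] at this
  refine this.congr_order ?_
  cases b <;> cases b' <;> simp [boolSign] <;> split_ifs <;> ring

/-- The generating function at the empty shape. -/
noncomputable def baseFactor (q ν : ℂ) (w : ℂ) : ℂ :=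
  ν * (ν - q * w) * (ν + q⁻¹ * w) * (ν ^ 2 - w) / ((ν ^ 2 - w ^ 2) * ν ^ 2 * (1 - w))

/-- Ensures that the factors of `baseFactor` with roots `ν * q⁻¹`, `-(ν * q)` and `±ν` do not affect
orders at contents. -/
lemma GenericParams.nu_mul_ne_content {q ν : ℂ} (g : GenericParams q ν) (e : ℤ) (l : ℤ) (b : Bool) :
    ν * q ^ e ≠ letterContent q ν l b ∧ -(ν * q ^ e) ≠ letterContent q ν l b := by
  have hq := g.q_ne
  have hν := g.nu_ne
  cases b
  · simp only [letterContent, Bool.false_eq_true, if_false]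
    have e1 : ν ^ 2 * q ^ (-(2 * l)) * q ^ (2 * l) = ν * ν := by
      rw [mul_assoc, ← zpow_add₀ hq]; simp [sq]
    constructor
    · intro h
      apply (g.nu_pow (e + 2 * l)).1
      rw [← h, mul_assoc, ← zpow_add₀ hq] at e1
      exact (mul_left_cancel₀ hν e1).symm
    · intro h
      apply (g.nu_pow (e + 2 * l)).2
      rw [← h, neg_mul, mul_assoc, ← zpow_add₀ hq] at e1
      exact mul_left_cancel₀ hν (by rw [← e1]; ring)
  · simp only [letterContent, if_true]
    have e1 : ν * q ^ e * q ^ (-e) = ν := by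
      rw [mul_assoc, ← zpow_add₀ hq]; simp
    constructor
    · intro h
      apply (g.nu_pow (2 * l + -e)).1
      rw [zpow_add₀ hq, ← h, e1]
    · intro h
      apply (g.nu_pow (2 * l + -e)).2
      rw [zpow_add₀ hq, ← h, neg_mul, e1, neg_neg]

lemma content_zero_true (q ν : ℂ) : letterContent q ν 0 true = 1 := by simp [letterContent]

lemma content_zero_false (q ν : ℂ) : letterContent q ν 0 false = ν ^ 2 := by simp [letterContent]

lemma hasOrderAt_baseFactor {q ν : ℂ} (g : GenericParams q ν) (k : ℤ) (b : Bool) :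
    HasOrderAt (baseFactor q ν) (letterContent q ν k b) (-(boolSign b * descent emptyShape k)) := by
  classical
  have hq := g.q_ne
  have hν := g.nu_ne
  set c := letterContent q ν k b with hc
  have n1 := (g.nu_mul_ne_content (-1) k b).1
  have n2 := (g.nu_mul_ne_content 1 k b).2
  have n3 := (g.nu_mul_ne_content 0 k b).1
  have n4 := (g.nu_mul_ne_content 0 k b).2
  simp only [zpow_neg, zpow_one, zpow_zero, mul_one, ← hc] at n1 n2 n3 n4
  have h1 : HasOrderAt (fun w => ν - q * w) c 0 := by
    have := hasOrderAt_linear (c := c) (d := ν * q⁻¹) hq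
    rw [if_neg n1] at this
    convert this using 2 with w
    field_simp
  have h2 : HasOrderAt (fun w => ν + q⁻¹ * w) c 0 := by
    have := hasOrderAt_linear (c := c) (d := -(ν * q)) (neg_ne_zero.mpr (inv_ne_zero hq))
    rw [if_neg n2] at this
    convert this using 2 with w
    field_simp
    ring
  have h3 : HasOrderAt (fun w => ν ^ 2 - w ^ 2) c 0 := by
    have h5 := hasOrderAt_linear (c := c) (d := ν) one_ne_zero
    have h6 := hasOrderAt_linear (c := c) (d := -ν) (neg_ne_zero.mpr (one_ne_zero (α := ℂ)))
    rw [if_neg n3] at h5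
    rw [if_neg n4] at h6
    convert (h5.mul h6).congr_order (add_zero 0) using 2 with w
    ring
  have h4 : HasOrderAt (fun w => ν ^ 2 - w) c (if 0 = k ∧ false = b then 1 else 0) := by
    have := hasOrderAt_linear (c := c) (d := letterContent q ν 0 false) one_ne_zero
    simp only [one_mul, hc, g.content_eq_iff] at this
    simpa only [content_zero_false] using this
  have h5 : HasOrderAt (fun w => 1 - w) c (if 0 = k ∧ true = b then 1 else 0) := by
    have := hasOrderAt_linear (c := c) (d := letterContent q ν 0 true) one_ne_zero
    simp only [one_mul, hc, g.content_eq_iff] at this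
    simpa only [content_zero_true] using this
  have := ((((hasOrderAt_const hν).mul h1).mul h2).mul h4).div
    ((h3.mul (hasOrderAt_const (pow_ne_zero 2 hν))).mul h5)
  refine this.congr_order ?_
  unfold descent emptyShape boolInd boolSign
  by_cases e : k = 0
  · subst e; cases b <;> simp
  · have : decide (k ≤ 0) = decide (k + 1 ≤ 0) := by
      rw [decide_eq_decide]; omega
    rw [this]
    simp [Ne.symm e]

end

/-! ### The generating function of the compressed powers of `y i` -/

section

open Polynomial Filter

lemma eventually_isUnit_smul_sub {V : Type*} [AddCommGroup V] [Module ℂ V] [FiniteDimensional ℂ V]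
    (f : Module.End ℂ V) : ∀ᶠ w : ℂ in cofinite, IsUnit (w • (1 : Module.End ℂ V) - f) := by
  have h := Module.End.finite_spectrum f
  have : {w : ℂ | ¬ IsUnit (w • (1 : Module.End ℂ V) - f)} = spectrum ℂ f := by
    ext w
    simp [spectrum.mem_iff, Algebra.algebraMap_eq_smul_one]
  rw [Filter.eventually_cofinite, this]
  exact h

lemma baseFactor_eq {q ν : ℂ} (g : GenericParams q ν) {w : ℂ} (h1 : w - 1 ≠ 0)
    (h2 : ν ^ 2 - w ^ 2 ≠ 0) :
    (q - q⁻¹) * loopParam q ν * w * (w - 1)⁻¹ =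
      baseFactor q ν w - ν - (q - q⁻¹) * w ^ 2 / (ν ^ 2 - w ^ 2) := by
  have hq := g.q_ne
  have hν := g.nu_ne
  have h1' : 1 - w ≠ 0 := by rw [← neg_ne_zero, neg_sub]; exact h1
  rw [g.delta_mul_loopParam, show (w - 1)⁻¹ = -(1 - w)⁻¹ by rw [← neg_sub, inv_neg]]
  unfold baseFactor
  field_simp
  ring

/-- The recursion of `kappa_resolvent_kappa_step` is affine in `z`. Adding `ν + d * w ^ 2 / (ν ^ 2 -
w ^ 2)` to `d * w * z` makes it purely multiplicative, so that orders simply add along a path. -/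
lemma stepFactor_eq {q ν : ℂ} (g : GenericParams q ν) {w F : ℂ} {l : ℤ} {b : Bool}
    (hw : w ≠ 0) (h1 : w - letterContent q ν l b ≠ 0) (h2 : w * letterContent q ν l b - ν ^ 2 ≠ 0)
    (h3 : ν ^ 2 - w ^ 2 ≠ 0)
    (h4 : (w - letterContent q ν l b) ^ 2 - (q - q⁻¹) ^ 2 * w * letterContent q ν l b ≠ 0)
    {d a z : ℂ} (hd : d = q - q⁻¹) (ha : a = letterContent q ν l b)
    (hz : z = (F - ν - d * w ^ 2 / (ν ^ 2 - w ^ 2)) / (d * w)) :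
    d * w * ((w - a) ^ 2 * z + d * a * (ν - d - d * ν ^ 2 * (w * a - ν ^ 2)⁻¹)
        - (w - a) ^ 2 * (d * ν ^ 2 * (w * a - ν ^ 2)⁻¹ *
          (ν * a * (w * a - ν ^ 2)⁻¹ - d * ν ^ 2 * (w * a - ν ^ 2)⁻¹ * (w - a)⁻¹
            + d * ν ^ 2 * z * (w * a - ν ^ 2)⁻¹ - d * (w - a)⁻¹ + d * z))) =
      ((w - a) ^ 2 - d ^ 2 * w * a) *
        (F * stepFactor q ν l b w - ν - d * w ^ 2 / (ν ^ 2 - w ^ 2)) := by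
  have hq := g.q_ne
  have hd0 : d ≠ 0 := hd ▸ g.delta_ne
  have hdd : d ^ 2 = q ^ 2 + (q ^ 2)⁻¹ - 2 := by
    have := g.q_ne
    rw [hd]; field_simp; ring
  rw [← ha] at h1 h2 h4
  rw [← hd] at h4
  have e1 : letterContent q ν (l + 1) b + letterContent q ν (l - 1) b = (q ^ 2 + (q ^ 2)⁻¹) * a := by
    rw [g.content_add_one, g.content_sub_one, ha]; cases b <;> simp <;> ring
  have e2 : letterContent q ν (l + 1) b * letterContent q ν (l - 1) b = a ^ 2 := by
    rw [g.content_add_one, g.content_sub_one, ha]; cases b <;> simp <;> field_simp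
  have n1 : (letterContent q ν (l + 1) b - w) * (letterContent q ν (l - 1) b - w) =
      (w - a) ^ 2 - d ^ 2 * w * a := by
    rw [hdd]; linear_combination e2 - w * e1
  have n2 : (ν ^ 2 - letterContent q ν (l + 1) b * w) * (ν ^ 2 - letterContent q ν (l - 1) b * w) =
      (w * a - ν ^ 2) ^ 2 - d ^ 2 * ν ^ 2 * a * w := by
    rw [hdd]; linear_combination w ^ 2 * e2 - w * ν ^ 2 * e1
  have hF : F = d * w * z + ν + d * w ^ 2 / (ν ^ 2 - w ^ 2) := by
    rw [hz]; field_simp; ring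
  have n3 : ((w - a) ^ 2 - d ^ 2 * w * a) * stepFactor q ν l b w =
      ((w * a - ν ^ 2) ^ 2 - d ^ 2 * ν ^ 2 * a * w) * (w - a) ^ 2 * (w * a - ν ^ 2)⁻¹ ^ 2 := by
    unfold stepFactor
    rw [n1, n2, ← ha, show ν ^ 2 - a * w = -(w * a - ν ^ 2) by ring]
    generalize (w - a) ^ 2 - d ^ 2 * w * a = P at h4
    field_simp
    ring
  have n4 : ((w - a) ^ 2 - d ^ 2 * w * a) *
        (F * stepFactor q ν l b w - ν - d * w ^ 2 / (ν ^ 2 - w ^ 2)) =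
      F * (((w * a - ν ^ 2) ^ 2 - d ^ 2 * ν ^ 2 * a * w) * (w - a) ^ 2 * (w * a - ν ^ 2)⁻¹ ^ 2)
        - ((w - a) ^ 2 - d ^ 2 * w * a) * (ν + d * w ^ 2 / (ν ^ 2 - w ^ 2)) := by
    rw [← n3]; ring
  rw [n4, hF]
  field_simp
  ring

namespace BMWFamily

variable {q ν : ℂ} {M : ℕ}
variable {V : Type*} [AddCommGroup V] [Module ℂ V] {s t : ℕ → Module.End ℂ V}

local notation:max "κ" i:max => kappaOf q ν (s i)
local notation:max "y" i:max => jucysMurphy s i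

variable (g : GenericParams q ν) (h : BMWFamily q ν M s t)
include g h

omit g in
lemma jm_isUnit : ∀ {k : ℕ}, k ≤ M → IsUnit (y k)
  | 0, _ => isUnit_one
  | k + 1, hk => by
    have hs : IsUnit (s k) := ⟨⟨s k, t k, h.mul_inv k hk, h.inv_mul k hk⟩, rfl⟩
    exact (hs.mul (jm_isUnit (by omega))).mul hs

omit g in
lemma eventually_isUnit_smul_jm_sub [FiniteDimensional ℂ V] {i : ℕ} (hi : i ≤ M) :
    ∀ᶠ w : ℂ in cofinite, IsUnit (w • y i - ν ^ 2 • 1) := by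
  obtain ⟨x, hx⟩ := h.jm_isUnit hi
  filter_upwards [eventually_isUnit_smul_sub (ν ^ 2 • (↑x⁻¹ : Module.End ℂ V))] with w hw
  have : w • y i - ν ^ 2 • 1 = (w • 1 - ν ^ 2 • (↑x⁻¹ : Module.End ℂ V)) * y i := by
    rw [sub_mul, smul_mul_assoc, smul_mul_assoc, one_mul, ← hx, Units.inv_mul]
  rw [this]
  exact hw.mul (h.jm_isUnit hi)

/-- The compression of the resolvent of `y_i` by `κ_i` acts on a weight space by a rational
function with simple poles exactly at the contents of the letters allowed in the shape. -/
theorem exists_generating_function [FiniteDimensional ℂ V] {a : ℕ → ℂ} : ∀ {i : ℕ}, i < M →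
    ∀ {χ : ℤ → Bool}, IsPath q ν a i χ → ∃ F : ℂ → ℂ,
    (∀ k b, HasOrderAt F (letterContent q ν k b) (-(boolSign b * descent χ k))) ∧
    ∀ᶠ w in cofinite, ∀ R : Module.End ℂ V, (w • 1 - y i) * R = 1 → R * (w • 1 - y i) = 1 →
      ∀ u : V, (∀ j < i, y j u = a j • u) →
        ((q - q⁻¹) * w) • κ i (R (κ i u)) =
          (F w - ν - (q - q⁻¹) * w ^ 2 / (ν ^ 2 - w ^ 2)) • κ i u := by
  have hsq : ∀ᶠ w : ℂ in cofinite, ν ^ 2 - w ^ 2 ≠ 0 := by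
    filter_upwards [eventually_cofinite_ne ν, eventually_cofinite_ne (-ν)] with w h1 h2 h3
    rcases sq_eq_sq_iff_eq_or_eq_neg.mp (sub_eq_zero.mp h3) with h4 | h4
    · exact h1 h4.symm
    · exact h2 (by rw [h4, neg_neg])
  intro i
  induction i with
  | zero =>
    rintro hi χ rfl
    refine ⟨baseFactor q ν, hasOrderAt_baseFactor g, ?_⟩
    filter_upwards [hsq, eventually_cofinite_ne 1] with w hw hw1 R hR1 hR2 u _
    have hw1' := sub_ne_zero.mpr hw1
    have hR : ∀ v, R v = (w - 1)⁻¹ • v := by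
      intro v
      have := congrArg (fun f : Module.End ℂ V => f v) hR1
      simp only [jucysMurphy, Module.End.mul_apply, LinearMap.sub_apply, LinearMap.smul_apply,
        Module.End.one_apply] at this
      rw [eq_inv_smul_iff₀ hw1', sub_smul, one_smul, this]
    have hk : κ 0 (κ 0 u) = loopParam q ν • κ 0 u := by
      rw [← Module.End.mul_apply, h.kappa_sq g hi, LinearMap.smul_apply]
    rw [hR, map_smul, hk, smul_smul, smul_smul, ← baseFactor_eq g hw1' hw]
    congr 1
    ring
  | succ i ih =>
    rintro hi χ ⟨χ', l, b, hp, hall, ha, rfl⟩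
    obtain ⟨F, hF, hev⟩ := ih (by omega) hp
    refine ⟨fun w => F w * stepFactor q ν l b w, fun k b' => ?_, ?_⟩
    · refine ((hF k b').mul (hasOrderAt_stepFactor g l b k b')).congr_order ?_
      rw [descent_step hall]
      ring
    have hquad : ∀ᶠ w : ℂ in cofinite, (w - a i) ^ 2 - (q - q⁻¹) ^ 2 * w * a i ≠ 0 := by
      filter_upwards [eventually_cofinite_ne (q ^ 2 * a i),
        eventually_cofinite_ne ((q ^ 2)⁻¹ * a i)] with w h1 h2 h3
      have hq := g.q_ne
      have : (w - q ^ 2 * a i) * (w - (q ^ 2)⁻¹ * a i) = 0 := by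
        rw [← h3]; field_simp; ring
      rcases mul_eq_zero.mp this with h4 | h4
      · exact h1 (sub_eq_zero.mp h4)
      · exact h2 (sub_eq_zero.mp h4)
    have hlin : ∀ᶠ w : ℂ in cofinite, w * a i - ν ^ 2 ≠ 0 := by
      have ha0 : a i ≠ 0 := ha ▸ g.content_ne_zero l b
      filter_upwards [eventually_cofinite_ne (ν ^ 2 / a i)] with w h1 h2
      exact h1 (by rw [eq_div_iff ha0]; exact sub_eq_zero.mp h2)
    filter_upwards [hev, hsq, hquad, hlin, eventually_cofinite_ne 0, eventually_cofinite_ne (a i),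
      eventually_isUnit_smul_sub (y i), h.eventually_isUnit_smul_jm_sub (by omega : i ≤ M)]
      with w h1 h2 h3 h4 h5 h6 h7 h8 R' hR' hR'2 u hu
    obtain ⟨R, hR⟩ := h7
    obtain ⟨T, hT⟩ := h8
    have hd := g.delta_ne
    have hdw : (q - q⁻¹) * w ≠ 0 := mul_ne_zero hd h5
    have i1 : (w • 1 - y i) * (↑R⁻¹ : Module.End ℂ V) = 1 := by rw [← hR, Units.mul_inv]
    have i2 : (↑R⁻¹ : Module.End ℂ V) * (w • 1 - y i) = 1 := by rw [← hR, Units.inv_mul]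
    have i3 : (w • y i - ν ^ 2 • 1) * (↑T⁻¹ : Module.End ℂ V) = 1 := by rw [← hT, Units.mul_inv]
    have i4 : (↑T⁻¹ : Module.End ℂ V) * (w • y i - ν ^ 2 • 1) = 1 := by rw [← hT, Units.inv_mul]
    -- The induction hypothesis is used for `κ (i + 1) u`, which has the same first `i` eigenvalues
    -- as `u`.
    have hz := h1 _ i1 i2 (κ (i + 1) u) (by
      intro j hj
      rw [← Module.End.mul_apply, ← (h.kappa_comm_jm hi (by omega) (by omega) (by omega) :
        Commute (κ (i + 1)) (y j)).eq, Module.End.mul_apply, hu j (by omega), map_smul])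
    rw [← eq_inv_smul_iff₀ hdw, smul_smul] at hz
    have hstep := h.kappa_resolvent_kappa_step g hi i1 i2 hR'2 hR' i3 i4 (sub_ne_zero.mpr h6) h4
      (hu i (by omega)) hz
    have hs := stepFactor_eq g (w := w) (F := F w) (l := l) (b := b) (d := q - q⁻¹) (a := a i)
      (z := ((q - q⁻¹) * w)⁻¹ * (F w - ν - (q - q⁻¹) * w ^ 2 / (ν ^ 2 - w ^ 2))) h5
      (ha ▸ sub_ne_zero.mpr h6) (ha ▸ h4) h2 (ha ▸ h3) rfl ha (div_eq_inv_mul _ _).symm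
    have := congrArg (fun v => ((q - q⁻¹) * w) • v) hstep
    simp only [smul_smul] at this
    rw [hs, mul_comm ((q - q⁻¹) * w), mul_smul _ ((q - q⁻¹) * w),
      mul_smul ((w - a i) ^ 2 - (q - q⁻¹) ^ 2 * w * a i) (_ - _ - _)] at this
    exact smul_right_injective V h3 this

end BMWFamily

end

/-! ### Producing eigenvectors with a prescribed string -/

section

open Polynomial Filter

section Eigenvectors

variable {V : Type*} [AddCommGroup V] [Module ℂ V]

lemma exists_eigenvector_or_surjective [FiniteDimensional ℂ V] (f : Module.End ℂ V)
    (W : Submodule ℂ V) (hW : ∀ u ∈ W, f u ∈ W) (x : ℂ) :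
    (∃ u ∈ W, u ≠ 0 ∧ f u = x • u) ∨ ∀ w ∈ W, ∃ u ∈ W, f u - x • u = w := by
  by_cases h : ∃ u ∈ W, u ≠ 0 ∧ f u = x • u
  · exact Or.inl h
  refine Or.inr fun w hw => ?_
  push Not at h
  let F : W →ₗ[ℂ] W := (f - x • (1 : Module.End ℂ V)).restrict
    (fun u hu => W.sub_mem (hW u hu) (W.smul_mem x hu))
  have hF : Function.Injective F := by
    rw [← LinearMap.ker_eq_bot, LinearMap.ker_eq_bot']
    rintro ⟨u, hu⟩ h0
    have h1 : f u - x • u = 0 := congrArg Subtype.val h0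
    by_contra hne
    exact h u hu (fun h2 => hne (Subtype.ext h2)) (sub_eq_zero.mp h1)
  obtain ⟨⟨u, hu⟩, hu2⟩ := (LinearMap.injective_iff_surjective.mp hF) ⟨w, hw⟩
  exact ⟨u, hu, congrArg Subtype.val hu2⟩

lemma exists_eigenvector_or_polynomial [FiniteDimensional ℂ V] (f : Module.End ℂ V)
    (W : Submodule ℂ V) (hW : ∀ u ∈ W, f u ∈ W) (x : ℂ) :
    (∃ u ∈ W, u ≠ 0 ∧ f u = x • u) ∨
      ∃ p : ℂ[X], p.eval x ≠ 0 ∧ ∀ w ∈ W, aeval f p w = 0 := by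
  let F : Module.End ℂ W := f.restrict hW
  by_cases hx : F.HasEigenvalue x
  · obtain ⟨⟨u, hu⟩, hu2⟩ := hx.exists_hasEigenvector
    refine Or.inl ⟨u, hu, fun h => hu2.2 (Subtype.ext h), ?_⟩
    exact congrArg Subtype.val (Module.End.mem_eigenspace_iff.mp hu2.1)
  · refine Or.inr ⟨minpoly ℂ F, fun h => hx (Module.End.hasEigenvalue_iff_isRoot.mpr h), ?_⟩
    have key : ∀ (p : ℂ[X]) (w : W), (aeval F p w : V) = aeval f p (w : V) := by
      intro p
      induction p using Polynomial.induction_on' with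
      | add p p' h1 h2 => intro w; simp [h1, h2]
      | monomial n c =>
        intro w
        have : ((F ^ n) w : V) = (f ^ n) (w : V) := by
          induction n with
          | zero => rfl
          | succ n ih => rw [pow_succ', pow_succ', Module.End.mul_apply, Module.End.mul_apply, ← ih]; rfl
        simp [aeval_monomial, this]
    intro w hw
    have := key (minpoly ℂ F) ⟨w, hw⟩
    rw [minpoly.aeval] at this
    exact this.symm

/-- `w - f` divides `p(w) - p(f)`, so the resolvent cancels and only a polynomial in `w` remains. If
`p(f)` kills `x`, this confines the poles of the matrix coefficient to the roots of `p`. -/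
lemma exists_polynomial_resolvent (f : Module.End ℂ V) (φ : V →ₗ[ℂ] ℂ) (x : V) (p : ℂ[X]) :
    ∃ Q : ℂ[X], ∀ (w : ℂ) (R : Module.End ℂ V), R * (w • 1 - f) = 1 →
      φ (R (p.eval w • x - aeval f p x)) = Q.eval w := by
  induction p using Polynomial.induction_on' with
  | add p p' h1 h2 =>
    obtain ⟨Q, hQ⟩ := h1
    obtain ⟨Q', hQ'⟩ := h2
    refine ⟨Q + Q', fun w R hR => ?_⟩
    rw [eval_add, eval_add, ← hQ w R hR, ← hQ' w R hR, ← map_add, ← map_add]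
    congr 2
    simp only [map_add, LinearMap.add_apply]
    module
  | monomial n c =>
    suffices ∃ Q : ℂ[X], ∀ (w : ℂ) (R : Module.End ℂ V), R * (w • 1 - f) = 1 →
        φ (R (w ^ n • x - (f ^ n) x)) = Q.eval w by
      obtain ⟨Q, hQ⟩ := this
      refine ⟨C c * Q, fun w R hR => ?_⟩
      rw [eval_mul, eval_C, ← hQ w R hR, ← smul_eq_mul, ← map_smul, ← map_smul]
      congr 2
      simp only [eval_monomial, aeval_monomial, Module.End.mul_apply,
        Module.algebraMap_end_apply]
      module
    induction n with
    | zero => exact ⟨0, fun w R _ => by simp⟩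
    | succ n ih =>
      obtain ⟨Q, hQ⟩ := ih
      refine ⟨X * Q + C (φ ((f ^ n) x)), fun w R hR => ?_⟩
      have h1 := congrArg (fun T : Module.End ℂ V => T ((f ^ n) x)) hR
      simp only [Module.End.mul_apply, LinearMap.sub_apply, LinearMap.smul_apply,
        Module.End.one_apply] at h1
      rw [eval_add, eval_mul, eval_X, eval_C, ← hQ w R hR, ← smul_eq_mul, ← map_smul, ← map_smul]
      rw [show φ ((f ^ n) x) = φ (R (w • (f ^ n) x - f ((f ^ n) x))) by rw [h1], ← map_add, ← map_add]
      congr 2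
      rw [pow_succ' f, Module.End.mul_apply, pow_succ']
      module

end Eigenvectors

/-- `v` is a common eigenvector of the first `L` Jucys-Murphy elements. -/
def IsWeight {V : Type*} [AddCommGroup V] [Module ℂ V] (s : ℕ → Module.End ℂ V) (a : ℕ → ℂ)
    (L : ℕ) (v : V) : Prop :=
  v ≠ 0 ∧ ∀ j < L, jucysMurphy s j v = a j • v

namespace BMWFamily

variable {q ν : ℂ} {M : ℕ}
variable {V : Type*} [AddCommGroup V] [Module ℂ V] {s t : ℕ → Module.End ℂ V}

local notation:max "κ" i:max => kappaOf q ν (s i)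
local notation:max "y" i:max => jucysMurphy s i

omit [Module ℂ V] in
lemma apply_comm [Module ℂ V] {f g : Module.End ℂ V} (h : Commute f g) (v : V) : f (g v) = g (f v) := by
  rw [← Module.End.mul_apply, h.eq, Module.End.mul_apply]

lemma _root_.IsWeight.mono {a : ℕ → ℂ} {L L' : ℕ} {v : V} (hv : IsWeight s a L v) (h : L' ≤ L) :
    IsWeight s a L' v := ⟨hv.1, fun j hj => hv.2 j (by omega)⟩

variable (g : GenericParams q ν) (h : BMWFamily q ν M s t)
include g h

lemma kappa_apply_eq_zero {i : ℕ} (hi : i < M) {v : V} {a b : ℂ} (h1 : y i v = a • v)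
    (h2 : y (i + 1) v = b • v) (hab : a * b ≠ ν ^ 2) : κ i v = 0 := by
  have := LinearMap.congr_fun (h.kappa_jm_jm g hi) v
  simp only [Module.End.mul_apply, h2, map_smul, h1, LinearMap.smul_apply, smul_smul] at this
  rw [← sub_eq_zero, ← sub_smul, smul_eq_zero, sub_eq_zero, mul_comm] at this
  exact this.resolve_left hab

lemma inv_apply {i : ℕ} (hi : i < M) {v : V} (hk : κ i v = 0) :
    t i v = s i v - (q - q⁻¹) • v := by
  rw [h.inv_eq g hi]
  simp [hk]

lemma sigma_sigma_apply {i : ℕ} (hi : i < M) {v : V} (hk : κ i v = 0) :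
    s i (s i v) = (q - q⁻¹) • s i v + v := by
  have h1 := LinearMap.congr_fun (h.mul_inv i hi) v
  rw [Module.End.mul_apply, h.inv_apply g hi hk, map_sub, map_smul, Module.End.one_apply] at h1
  nth_rewrite 3 [← h1]
  abel

omit g in
lemma jm_sigma_apply {i : ℕ} (hi : i < M) {v : V} : y i (s i v) = t i (y (i + 1) v) := by
  rw [← Module.End.mul_apply, ← h.inv_mul_jm_succ hi, Module.End.mul_apply]

lemma jm_succ_sigma_apply {i : ℕ} (hi : i < M) {v : V} (hk : κ i v = 0) :
    y (i + 1) (s i v) = s i (y i v) + (q - q⁻¹) • y (i + 1) v := by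
  have := LinearMap.congr_fun (h.jm_succ_mul_inv hi) v
  rw [Module.End.mul_apply, h.inv_apply g hi hk, map_sub, map_smul, Module.End.mul_apply] at this
  rw [← this]; abel

/-- The Hecke-type local analysis: an eigenvector killed by `κ_i` is either moved to the
transposed weight or is an eigenvector of `σ_i`. -/
lemma hecke_alternative {i L : ℕ} (hi : i < M) (hL : i + 2 ≤ L) (hLM : L ≤ M + 1) {a : ℕ → ℂ} {v : V}
    (hv : IsWeight s a L v) (hk : κ i v = 0) (hne : a i ≠ a (i + 1)) :
    (∃ u, IsWeight s (a ∘ Equiv.swap i (i + 1)) L u) ∨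
      (a (i + 1) = q ^ 2 * a i ∧ s i v = q • v) ∨
      (a (i + 1) = (q ^ 2)⁻¹ * a i ∧ s i v = (-q⁻¹) • v) := by
  have hq := g.q_ne
  have hd : a i - a (i + 1) ≠ 0 := sub_ne_zero.mpr hne
  have y1 := hv.2 i (by omega)
  have y2 := hv.2 (i + 1) (by omega)
  set d := q - q⁻¹ with hddef
  -- The unique constant for which `y i` multiplies `s i v + A • v` by `a (i + 1)`. If that vector
  -- vanishes, the quadratic relation on `v` forces `A = -q` or `A = q⁻¹`, which fixes the ratio of
  -- the eigenvalues.
  set A := d * a (i + 1) / (a i - a (i + 1)) with hA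
  have hA' : A * (a i - a (i + 1)) = d * a (i + 1) := div_mul_cancel₀ _ hd
  by_cases hu : s i v + A • v = 0
  · right
    have hs : s i v = (-A) • v := by rw [neg_smul]; exact eq_neg_of_add_eq_zero_left hu
    have h2 := h.sigma_sigma_apply g hi hk
    rw [hs, map_smul, hs] at h2
    have h3 : ((A + q) * (A - q⁻¹)) • v = 0 := by
      have : q * q⁻¹ = 1 := mul_inv_cancel₀ hq
      have e : (A + q) * (A - q⁻¹) = A * A + d * A - 1 := by rw [hddef]; linear_combination -this
      rw [e]
      rw [← sub_eq_zero] at h2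
      rw [← h2]; module
    rcases mul_eq_zero.mp ((smul_eq_zero.mp h3).resolve_right hv.1) with h4 | h4
    · left
      have h5 : A = -q := by linear_combination h4
      rw [h5, hddef] at hA'
      refine ⟨?_, by rw [hs, h5, neg_neg]⟩
      field_simp at hA'
      linear_combination hA'
    · right
      have h5 : A = q⁻¹ := by linear_combination h4
      rw [h5, hddef] at hA'
      refine ⟨?_, by rw [hs, h5]⟩
      field_simp at hA' ⊢
      linear_combination -hA'
  · left
    refine ⟨_, hu, fun j hj => ?_⟩
    by_cases hj1 : j = i
    · subst hj1
      simp only [Function.comp, Equiv.swap_apply_left]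
      rw [map_add, map_smul, h.jm_sigma_apply hi, y2, y1, map_smul, h.inv_apply g hi hk]
      rw [show A • a j • v = (A * (a j - a (j + 1))) • v + (A * a (j + 1)) • v by module, hA']
      module
    by_cases hj2 : j = i + 1
    · subst hj2
      simp only [Function.comp, Equiv.swap_apply_right]
      rw [map_add, map_smul, h.jm_succ_sigma_apply g hi hk, y1, y2, map_smul, smul_add,
        show a i • A • v = (A * (a i - a (i + 1))) • v + (A * a (i + 1)) • v by module, hA']
      module
    · simp only [Function.comp, Equiv.swap_apply_of_ne_of_ne hj1 hj2]
      rw [map_add, map_smul, ← apply_comm (h.sigma_comm_jm hi j (by omega) hj1 hj2), hv.2 j hj,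
        map_smul]
      module

/-- If `a_p a_{p+1} = ν²` and `κ_p v ≠ 0`, the next eigenvalue is one that can follow the first
`p` entries. -/
lemma next_of_kappa_ne_zero [FiniteDimensional ℂ V] {p L : ℕ} (hp : p + 1 < M) (hL : p + 3 ≤ L)
    {a : ℕ → ℂ} {v : V} (hv : IsWeight s a L v) (hk : κ p v ≠ 0) :
    ∃ u, IsWeight s (Function.update a p (a (p + 2))) (p + 1) u := by
  have c1 : ∀ {j k}, j ≤ M → k ≤ M → ∀ v : V, y j (y k v) = y k (y j v) :=
    fun hj hk v => apply_comm (h.jm_comm hj hk) v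
  let W : Submodule ℂ V :=
    { carrier := {u | (∀ j < p, y j u = a j • u) ∧ y p (y (p + 1) u) = ν ^ 2 • u ∧
        y (p + 2) u = a (p + 2) • u}
      add_mem' := by
        rintro u u' ⟨h1, h2, h3⟩ ⟨h1', h2', h3'⟩
        exact ⟨fun j hj => by rw [map_add, h1 j hj, h1' j hj, smul_add],
          by rw [map_add, map_add, h2, h2', smul_add], by rw [map_add, h3, h3', smul_add]⟩
      zero_mem' := ⟨fun j _ => by simp, by simp, by simp⟩
      smul_mem' := by
        rintro c u ⟨h1, h2, h3⟩
        exact ⟨fun j hj => by rw [map_smul, h1 j hj, smul_comm],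
          by rw [map_smul, map_smul, h2, smul_comm], by rw [map_smul, h3, smul_comm]⟩ }
  have hW : ∀ u ∈ W, y p u ∈ W := by
    rintro u ⟨h1, h2, h3⟩
    refine ⟨fun j hj => ?_, ?_, ?_⟩
    · rw [c1 (by omega) (by omega), h1 j hj, map_smul]
    · rw [c1 (by omega) (by omega) u, h2, map_smul]
    · rw [c1 (by omega) (by omega), h3, map_smul]
  have hkW : κ p v ∈ W := by
    refine ⟨fun j hj => ?_, ?_, ?_⟩
    · rw [← apply_comm (h.kappa_comm_jm (by omega) (by omega) (by omega) (by omega)),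
        hv.2 j (by omega), map_smul]
    · have := LinearMap.congr_fun (h.jm_jm_kappa g (by omega : p < M)) v
      simpa only [Module.End.mul_apply, LinearMap.smul_apply] using this
    · rw [← apply_comm (h.kappa_comm_jm (by omega) (by omega) (by omega) (by omega)),
        hv.2 (p + 2) (by omega), map_smul]
  rcases exists_eigenvector_or_surjective (y p) W hW (a (p + 2)) with ⟨u, hu, hu0, hu1⟩ | hsurj
  · refine ⟨u, hu0, fun j hj => ?_⟩
    rcases Nat.lt_succ_iff_lt_or_eq.mp hj with hj | rfl
    · rw [Function.update_of_ne (by omega), hu.1 j hj]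
    · rw [Function.update_self, hu1]
  -- Write `κ p v = (y p - a (p + 2)) u` with `u ∈ W`. The relation of `κ (p + 1)` with `y (p + 1) *
  -- y (p + 2)`, and `y p * y (p + 1) = ν ^ 2` on `W`, show that `κ (p + 1)` kills this vector; then
  -- `κ p * κ (p + 1) * κ p = κ p` gives `κ p v = 0`.
  · exfalso
    obtain ⟨u, ⟨-, h2, h3⟩, hu⟩ := hsurj _ hkW
    have e1 := LinearMap.congr_fun (h.kappa_jm_jm g hp) u
    simp only [Module.End.mul_apply, LinearMap.smul_apply] at e1
    rw [show p + 1 + 1 = p + 2 from rfl, h3, map_smul, map_smul] at e1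
    have e2 := LinearMap.congr_arg (f := y p) e1
    have hc := h.kappa_comm_jm hp (by omega : p ≤ M) (by omega) (by omega)
    rw [map_smul, map_smul, ← apply_comm hc, ← apply_comm hc, h2, map_smul, smul_comm] at e2
    have e3 := smul_right_injective V (pow_ne_zero 2 g.nu_ne) e2
    have e4 : κ (p + 1) (κ p v) = 0 := by
      rw [← hu, map_sub, map_smul, ← e3, sub_self]
    have e5 := LinearMap.congr_fun (h.kappa_kappa_kappa g hp) v
    simp only [Module.End.mul_apply, e4, map_zero] at e5
    exact hk e5.symm

/-- All letters allowed in the shape occur in the span of a vector in the image of `κ_i`. -/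
lemma kappa_move [FiniteDimensional ℂ V] {i L : ℕ} (hi : i < M) (hL : i + 2 ≤ L) (hLM : L ≤ M + 1)
    {a : ℕ → ℂ} {v : V} (hv : IsWeight s a L v) (hk : κ i v ≠ 0) {χ : ℤ → Bool}
    (hχ : IsPath q ν a i χ) {k : ℤ} {b : Bool} (hkb : Allowed χ k b) :
    ∃ u, IsWeight s (Function.update (Function.update a i (letterContent q ν k b)) (i + 1)
      (letterContent q ν k (!b))) L u := by
  have c1 : ∀ {j k}, j ≤ M → k ≤ M → ∀ v : V, y j (y k v) = y k (y j v) :=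
    fun hj hk v => apply_comm (h.jm_comm hj hk) v
  set c := letterContent q ν k b with hc
  let W : Submodule ℂ V :=
    { carrier := {u | (∀ j < L, j ≠ i → j ≠ i + 1 → y j u = a j • u) ∧
        y i (y (i + 1) u) = ν ^ 2 • u}
      add_mem' := by
        rintro u u' ⟨h1, h2⟩ ⟨h1', h2'⟩
        exact ⟨fun j hj hj1 hj2 => by rw [map_add, h1 j hj hj1 hj2, h1' j hj hj1 hj2, smul_add],
          by rw [map_add, map_add, h2, h2', smul_add]⟩
      zero_mem' := ⟨fun j _ _ _ => by simp, by simp⟩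
      smul_mem' := by
        rintro c u ⟨h1, h2⟩
        exact ⟨fun j hj hj1 hj2 => by rw [map_smul, h1 j hj hj1 hj2, smul_comm],
          by rw [map_smul, map_smul, h2, smul_comm]⟩ }
  have hW : ∀ u ∈ W, y i u ∈ W := by
    rintro u ⟨h1, h2⟩
    refine ⟨fun j hj hj1 hj2 => ?_, ?_⟩
    · rw [c1 (by omega) (by omega), h1 j hj hj1 hj2, map_smul]
    · rw [c1 (by omega) (by omega) u, h2, map_smul]
  have hkW : κ i v ∈ W := by
    refine ⟨fun j hj hj1 hj2 => ?_, ?_⟩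
    · rw [← apply_comm (h.kappa_comm_jm (by omega) (by omega) hj1 hj2), hv.2 j (by omega), map_smul]
    · have := LinearMap.congr_fun (h.jm_jm_kappa g hi) v
      simpa only [Module.End.mul_apply, LinearMap.smul_apply] using this
  rcases exists_eigenvector_or_polynomial (y i) W hW c with ⟨u, hu, hu0, hu1⟩ | ⟨p, hpc, hp⟩
  · refine ⟨u, hu0, fun j hj => ?_⟩
    by_cases hj1 : j = i
    · subst hj1
      rw [Function.update_of_ne (by omega), Function.update_self, hu1]
    by_cases hj2 : j = i + 1
    · subst hj2
      rw [Function.update_self]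
      have e := hu.2
      rw [c1 (by omega) (by omega), hu1, map_smul, ← g.content_mul_not k b, ← hc, mul_smul] at e
      exact smul_right_injective V (g.content_ne_zero k b) e
    · rw [Function.update_of_ne hj2, Function.update_of_ne hj1, hu.1 j hj hj1 hj2]
  -- Without such an eigenvector the matrix coefficient of the resolvent on `κ i v` is regular at
  -- `c`, as `p` does not vanish there; but `c` is the content of an allowed letter, where `F` has a
  -- simple pole.
  · exfalso
    obtain ⟨F, hF, hev⟩ := h.exists_generating_function g hi hχ
    obtain ⟨φ, hφ⟩ : ∃ φ : Module.Dual ℂ V, φ (κ i v) ≠ 0 := by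
      by_contra hcon
      push Not at hcon
      exact hk ((Module.forall_dual_apply_eq_zero_iff ℂ _).mp hcon)
    obtain ⟨Q, hQ⟩ := exists_polynomial_resolvent (y i) (φ ∘ₗ κ i) (κ i v) p
    obtain ⟨P, P', hP, hP', hFP⟩ := hF k b
    have hord : -(boolSign b * descent χ k) = -1 := by
      rw [descent_of_allowed hkb]; cases b <;> rfl
    rw [hord] at hFP
    have hcc : ν ^ 2 - c ^ 2 ≠ 0 := by
      intro h0
      have : c * c = ν ^ 2 := by linear_combination -h0
      have := (g.content_mul_eq_iff.mp this).2
      cases b <;> simp at this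
    -- The generating function identity with denominators cleared. It holds off a finite set, hence
    -- as polynomials; at `c` only the pole term survives.
    have hpoly : C (φ (κ i v)) * p * (P * (C (ν ^ 2) - X ^ 2) - (X - C c) * P' *
        (C ν * (C (ν ^ 2) - X ^ 2) + C (q - q⁻¹) * X ^ 2)) =
        C (q - q⁻¹) * X * Q * (X - C c) * P' * (C (ν ^ 2) - X ^ 2) := by
      apply Polynomial.eq_of_infinite_eval_eq
      rw [← Filter.frequently_cofinite_iff_infinite]
      apply Filter.Eventually.frequently
      have hsq : ∀ᶠ w : ℂ in cofinite, ν ^ 2 - w ^ 2 ≠ 0 := by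
        filter_upwards [eventually_cofinite_ne ν, eventually_cofinite_ne (-ν)] with w h1 h2 h3
        rcases sq_eq_sq_iff_eq_or_eq_neg.mp (sub_eq_zero.mp h3) with h4 | h4
        · exact h1 h4.symm
        · exact h2 (by rw [h4, neg_neg])
      have hP'0 : ∀ᶠ w : ℂ in cofinite, P'.eval w ≠ 0 := by
        have : P' ≠ 0 := by rintro rfl; simp at hP'
        rw [Filter.eventually_cofinite]
        refine (P'.roots.toFinset.finite_toSet).subset fun w hw => ?_
        simp only [ne_eq, not_not, Set.mem_ofPred_eq] at hw
        simp [this, hw]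
      filter_upwards [hev, hFP, hsq, hP'0, eventually_cofinite_ne c,
        eventually_isUnit_smul_sub (y i)] with w h1 h2 h3 h4 h5 ⟨R, hR⟩
      have i1 : (w • 1 - y i) * (↑R⁻¹ : Module.End ℂ V) = 1 := by rw [← hR, Units.mul_inv]
      have i2 : (↑R⁻¹ : Module.End ℂ V) * (w • 1 - y i) = 1 := by rw [← hR, Units.inv_mul]
      have e1 := hQ w _ i2
      have e2 := LinearMap.congr_arg (f := φ)
        (h1 _ i1 i2 v fun j hj => hv.2 j (by omega))
      rw [hp _ hkW, sub_zero, map_smul, map_smul, LinearMap.comp_apply, smul_eq_mul] at e1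
      simp only [map_smul, smul_eq_mul] at e2
      have h5' := sub_ne_zero.mpr h5
      rw [h2, zpow_neg_one, ← hc] at e2
      simp only [eval_mul, eval_sub, eval_add, eval_C, eval_X, eval_pow]
      rw [← e1]
      generalize q - q⁻¹ = d at *
      have e3 : d * w * φ (κ i ((↑R⁻¹ : Module.End ℂ V) (κ i v))) * ((w - c) * P'.eval w * (ν ^ 2 - w ^ 2)) =
          (P.eval w * (ν ^ 2 - w ^ 2) - (w - c) * P'.eval w * (ν * (ν ^ 2 - w ^ 2) + d * w ^ 2)) *
            φ (κ i v) := by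
        rw [e2]
        field_simp
        ring
      linear_combination (-(p.eval w)) * e3
    have := congrArg (Polynomial.eval c) hpoly
    simp only [eval_mul, eval_sub, eval_add, eval_C, eval_X, eval_pow, sub_self, zero_mul, mul_zero,
      sub_zero] at this
    exact mul_ne_zero (mul_ne_zero hφ hpc) (mul_ne_zero hP hcc) this

end BMWFamily

end

/-! ### Combinatorics of letters on Maya diagrams -/

lemma stepShape_comm (χ : ℤ → Bool) {k l : ℤ} (h1 : k ≠ l) (h2 : k ≠ l + 1) (h3 : l ≠ k + 1) :
    stepShape (stepShape χ k) l = stepShape (stepShape χ l) k := by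
  funext j
  by_cases e1 : j = l
  · subst e1
    rw [stepShape_left, stepShape_of_ne _ (by omega) (by omega), stepShape_of_ne _ (by omega) h3,
      stepShape_left]
  by_cases e2 : j = l + 1
  · subst e2
    rw [stepShape_right, stepShape_of_ne _ (by omega) (by omega), stepShape_of_ne _ (by omega) (by omega),
      stepShape_right]
  rw [stepShape_of_ne _ e1 e2]
  by_cases e3 : j = k
  · subst e3
    rw [stepShape_left, stepShape_left, stepShape_of_ne _ (by omega) (by omega)]
  by_cases e4 : j = k + 1
  · subst e4
    rw [stepShape_right, stepShape_right, stepShape_of_ne _ (by omega) (by omega)]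
  rw [stepShape_of_ne _ e3 e4, stepShape_of_ne _ e3 e4, stepShape_of_ne _ e1 e2]

lemma allowed_stepShape_iff (χ : ℤ → Bool) {k l : ℤ} (b : Bool) (h1 : k ≠ l) (h2 : k ≠ l + 1)
    (h3 : l ≠ k + 1) : Allowed (stepShape χ l) k b ↔ Allowed χ k b := by
  unfold Allowed
  rw [stepShape_of_ne _ h1 h2, stepShape_of_ne _ (by omega) (by omega)]

/-- The site shared by the two edges would have to be both occupied and empty. -/
lemma Allowed.not_adjacent {χ : ℤ → Bool} {k l : ℤ} {b : Bool} (hl : Allowed χ l b)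
    (hk : Allowed χ k b) (h : k = l + 1 ∨ l = k + 1) : False := by
  rcases h with rfl | rfl
  · have := hl.2.symm.trans hk.1
    cases b <;> simp at this
  · have := hk.2.symm.trans hl.1
    cases b <;> simp at this

lemma Allowed.not_adjacent_step {χ : ℤ → Bool} {k l : ℤ} {b b' : Bool} (hl : Allowed χ l b)
    (hk : Allowed χ k b') (h : k = l + 1 ∨ l = k + 1) : ¬ Allowed (stepShape χ k) l b := by
  rcases h with rfl | rfl
  · intro h1
    have h3 := h1.2
    have h4 := hk.2
    rw [stepShape_left] at h3
    have h5 := hl.2.symm.trans hk.1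
    rw [h3, h5] at h4
    cases b' <;> simp at h4
  · intro h1
    have h3 := h1.1
    rw [stepShape_right] at h3
    have h4 := hk.2.symm.trans hl.1
    have h5 := hk.1.symm.trans h3
    rw [h5] at h4
    cases b <;> simp at h4

lemma Allowed.unique {χ : ℤ → Bool} {l : ℤ} {b b' : Bool} (h : Allowed χ l b) (h' : Allowed χ l b') :
    b = b' := h.1.symm.trans h'.1

/-- After a step along `l`, a neighbouring letter of the same kind is allowed unless the two edges
were both usable before. -/
lemma Allowed.step_or {χ : ℤ → Bool} {k l : ℤ} {b : Bool} (hl : Allowed χ l b)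
    (h : k = l + 1 ∨ l = k + 1) : Allowed (stepShape χ l) k b ∨ Allowed χ k (!b) := by
  rcases h with rfl | rfl
  · by_cases hb : χ (l + 1 + 1) = b
    · exact Or.inr ⟨hl.2, by rw [hb, Bool.not_not]⟩
    · refine Or.inl ⟨by rw [stepShape_right, hl.1], ?_⟩
      rw [stepShape_of_ne _ (by omega) (by omega)]
      exact Bool.eq_not_of_ne hb
  · by_cases hb : χ k = b
    · refine Or.inl ⟨?_, by rw [stepShape_left, hl.2]⟩
      rw [stepShape_of_ne _ (by omega) (by omega), hb]
    · exact Or.inr ⟨Bool.eq_not_of_ne hb, by rw [hl.1, Bool.not_not]⟩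

/-- A letter different from the one applied and its inverse remains allowed unless its edge is
adjacent. -/
lemma IsPath.letter {q ν : ℂ} (g : GenericParams q ν) {a a' : ℕ → ℂ} {m : ℕ} {χ χ' : ℤ → Bool}
    (h : IsPath q ν a m χ) (h' : IsPath q ν a' (m + 1) χ') (haa : ∀ j < m, a j = a' j) :
    ∃ k b, Allowed χ k b ∧ a' m = letterContent q ν k b ∧ χ' = stepShape χ k := by
  obtain ⟨χ'', k, b, h1, h2, h3, h4⟩ := h'
  obtain rfl := IsPath.unique g (h.congr haa) h1
  exact ⟨k, b, h2, h3, h4⟩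

namespace GenericParams

variable {q ν : ℂ} (g : GenericParams q ν)
include g

lemma adjacent_of_q_sq {l : ℤ} {b : Bool} {x : ℂ}
    (h : x = q ^ 2 * letterContent q ν l b ∨ x = (q ^ 2)⁻¹ * letterContent q ν l b) :
    ∃ k, (k = l + 1 ∨ l = k + 1) ∧ x = letterContent q ν k b := by
  rcases h with h | h
  · rw [g.q_sq_mul_content] at h
    exact ⟨_, by cases b <;> simp, h⟩
  · rw [g.q_sq_inv_mul_content] at h
    exact ⟨_, by cases b <;> simp, h⟩

lemma letters_of_q_sq {k l : ℤ} {b b' : Bool}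
    (h : letterContent q ν k b' = q ^ 2 * letterContent q ν l b ∨
      letterContent q ν k b' = (q ^ 2)⁻¹ * letterContent q ν l b) :
    (k = l + 1 ∨ l = k + 1) ∧ b' = b := by
  obtain ⟨k', h1, h2⟩ := g.adjacent_of_q_sq h
  obtain ⟨rfl, rfl⟩ := g.content_inj h2
  exact ⟨h1, rfl⟩

end GenericParams

/-! ### Strings are paths: the joint induction -/

/-- The first `m` eigenvalues of every common eigenvector form a path. -/
def WeightsArePaths {V : Type*} [AddCommGroup V] [Module ℂ V] (q ν : ℂ) (s : ℕ → Module.End ℂ V)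
    (m : ℕ) : Prop :=
  ∀ (a : ℕ → ℂ) (v : V), IsWeight s a m v → ∃ χ, IsPath q ν a m χ

/-- On common eigenspaces of the preceding ones, `y_m` has no Jordan blocks. -/
def NoJordanBlocks {V : Type*} [AddCommGroup V] [Module ℂ V] (s : ℕ → Module.End ℂ V)
    (m : ℕ) : Prop :=
  ∀ (a : ℕ → ℂ) (v : V) (c : ℂ), (∀ j < m, jucysMurphy s j v = a j • v) →
    jucysMurphy s m (jucysMurphy s m v - c • v) = c • (jucysMurphy s m v - c • v) →
      jucysMurphy s m v = c • v

namespace BMWFamily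

variable {q ν : ℂ} {M : ℕ}
variable {V : Type*} [AddCommGroup V] [Module ℂ V] {s t : ℕ → Module.End ℂ V}

local notation:max "κ" i:max => kappaOf q ν (s i)
local notation:max "y" i:max => jucysMurphy s i

variable (g : GenericParams q ν) (h : BMWFamily q ν M s t)
include g h

/-- If `κ i v = 0`, the Hecke alternative applies. Transposing would make a letter and its inverse
allowed in the same shape, and a ratio `q ^ (±2)` would relate letters of different kinds. -/
lemma kappa_ne_zero {i L : ℕ} (hi : i < M) (hL : i + 2 ≤ L) (hLM : L ≤ M + 1)
    (hT : WeightsArePaths q ν s (i + 1)) {a : ℕ → ℂ} {v : V} (hv : IsWeight s a L v)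
    (hprod : a i * a (i + 1) = ν ^ 2) : κ i v ≠ 0 := by
  intro hk
  obtain ⟨χ', χ, l, b, hp, hall, ha, rfl⟩ := hT a v (hv.mono (by omega))
  rw [ha] at hprod
  have ha' := g.eq_content_not hprod
  have hb : ∀ b : Bool, b ≠ !b := by decide
  rcases h.hecke_alternative g hi hL hLM hv hk (by
    rw [ha, ha']; intro h0; exact hb b (g.content_inj h0).2) with ⟨u, hu⟩ | ⟨h1, -⟩ | ⟨h1, -⟩
  · obtain ⟨χ₁, hχ₁⟩ := hT _ u (hu.mono (by omega))
    obtain ⟨k, b', h2, h3, -⟩ := hp.letter g hχ₁ (fun j hj => by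
      simp [Equiv.swap_apply_of_ne_of_ne (show j ≠ i by omega) (show j ≠ i + 1 by omega)])
    simp only [Function.comp, Equiv.swap_apply_left, ha'] at h3
    obtain ⟨rfl, rfl⟩ := g.content_inj h3
    exact hb b (hall.unique h2)
  · rw [ha, ha'] at h1
    exact hb b (g.letters_of_q_sq (Or.inl h1)).2.symm
  · rw [ha, ha'] at h1
    exact hb b (g.letters_of_q_sq (Or.inr h1)).2.symm

/-- Within the same module a path can be replaced by one to the same shape whose last step adds any
prescribed removable box. -/
lemma exists_weight_ending_with [FiniteDimensional ℂ V] : ∀ {m : ℕ},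
    (∀ j ≤ m, WeightsArePaths q ν s j) → ∀ {L : ℕ}, m ≤ L → L ≤ M + 1 → ∀ {a : ℕ → ℂ} {v : V},
    IsWeight s a L v → ∀ {χ : ℤ → Bool} {k : ℤ}, IsPath q ν a m χ → Allowed χ k false →
    ∃ n a' u, m = n + 1 ∧ IsWeight s a' L u ∧ (∀ j, m ≤ j → a' j = a j) ∧
      IsPath q ν a' n (stepShape χ k) ∧ a' n = letterContent q ν k true := by
  intro m
  induction m with
  | zero =>
    rintro - L - - a v - χ k rfl ⟨h1, h2⟩
    simp only [emptyShape, decide_eq_false_iff_not, Bool.not_false, decide_eq_true_eq] at h1 h2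
    omega
  | succ m ih =>
    rintro hT L hL hLM a v hv χ k ⟨χ', l, b, hp, hall, ha, rfl⟩ hk
    cases b with
    | true =>
      by_cases hkl : k = l
      · subst hkl
        exact ⟨m, a, v, rfl, hv, fun _ _ => rfl, by rwa [stepShape_stepShape], ha⟩
      have hk2 : k ≠ l + 1 := by
        rintro rfl
        have := hk.1
        rw [stepShape_right, hall.1] at this
        simp at this
      have hk3 : l ≠ k + 1 := by
        rintro rfl
        have := hk.2
        rw [stepShape_left, hall.2] at this
        simp at this
      -- The box `k` was already removable before the box `l` was added. By induction it can be
      -- added just before `l`, and the two additions are then transposed.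
      rw [allowed_stepShape_iff _ _ hkl hk2 hk3] at hk
      obtain ⟨n, a', u, rfl, hu, hj, hp', ha'⟩ :=
        ih (fun j hj => hT j (by omega)) (by omega) hLM hv hp hk
      have ha2 : a' (n + 1) = letterContent q ν l true := by rw [hj _ le_rfl, ha]
      have hkz : κ n u = 0 := h.kappa_apply_eq_zero g (by omega) (hu.2 n (by omega))
        (hu.2 (n + 1) (by omega)) (by
          rw [ha', ha2]; intro h0; simpa using (g.content_mul_eq_iff.mp h0).2)
      rcases h.hecke_alternative g (by omega) (by omega) hLM hu hkz (by
        rw [ha', ha2]; intro h0; exact hkl (g.content_inj h0).1) with ⟨u', hu'⟩ | ⟨h1, -⟩ | ⟨h1, -⟩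
      · refine ⟨n + 1, _, u', rfl, hu', fun j hjm => ?_, ⟨_, l, true, ?_, ?_, ?_,
          (stepShape_comm χ' hkl hk2 hk3).symm⟩, ?_⟩
        · simp only [Function.comp,
            Equiv.swap_apply_of_ne_of_ne (show j ≠ n by omega) (show j ≠ n + 1 by omega)]
          exact hj j (by omega)
        · exact hp'.congr fun j hjn => by
            simp [Equiv.swap_apply_of_ne_of_ne (show j ≠ n by omega) (show j ≠ n + 1 by omega)]
        · rwa [allowed_stepShape_iff _ _ (Ne.symm hkl) hk3 hk2]
        · simp [ha2]
        · simp [ha']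
      · rw [ha', ha2] at h1
        have := (g.letters_of_q_sq (Or.inl h1)).1
        omega
      · rw [ha', ha2] at h1
        have := (g.letters_of_q_sq (Or.inr h1)).1
        omega
    | false =>
      -- The last step removes `l`; by induction the step before may be taken to add `l`. This
      -- cancelling pair is exchanged by `kappa_move` for removing `k` and adding it back.
      obtain ⟨n, a', u, rfl, hu, hj, hp', ha'⟩ :=
        ih (fun j hj => hT j (by omega)) (by omega) hLM hv hp hall
      have ha2 : a' (n + 1) = letterContent q ν l false := by rw [hj _ le_rfl, ha]
      have hkn : κ n u ≠ 0 := h.kappa_ne_zero g (by omega) (by omega) hLM (hT (n + 1) (by omega)) hu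
        (by rw [ha', ha2, ← Bool.not_true, g.content_mul_not])
      obtain ⟨u', hu'⟩ := h.kappa_move g (by omega) (by omega) hLM hu hkn hp' hk
      refine ⟨n + 1, _, u', rfl, hu', fun j hjm => ?_, ⟨_, k, false, ?_, hk, ?_, rfl⟩, ?_⟩
      · rw [Function.update_of_ne (by omega), Function.update_of_ne (by omega), hj j (by omega)]
      · exact hp'.congr fun j hjn => by
          rw [Function.update_of_ne (by omega), Function.update_of_ne (by omega)]
      · rw [Function.update_of_ne (by omega), Function.update_self]
      · rw [Function.update_self, Bool.not_false]

/-- The situation in which the edges of the last two letters are adjacent and both usable before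
the two steps. -/
lemma allowed_of_adjacent [FiniteDimensional ℂ V] {n : ℕ} (hn : n < M)
    (hT : ∀ j ≤ n + 1, WeightsArePaths q ν s j) {a : ℕ → ℂ} {v : V} (hv : IsWeight s a (n + 2) v)
    {χ : ℤ → Bool} (hp : IsPath q ν a n χ) {k l : ℤ} {b b₀ b' : Bool} (hl : Allowed χ l b)
    (ha : a n = letterContent q ν l b) (hk : Allowed χ k b₀) (hkl : k = l + 1 ∨ l = k + 1)
    (hx : a (n + 1) = letterContent q ν k b') :
    ∃ k' b'', Allowed (stepShape χ l) k' b'' ∧ a (n + 1) = letterContent q ν k' b'' := by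
  have hkl' : k ≠ l := by omega
  cases b with
  | false =>
    -- Reroute so that the box removed at step `p + 1` is added at step `p`. The next eigenvalue may
    -- then follow the first `p` entries, whose shape is `stepShape χ l`.
    obtain ⟨p, a', u, rfl, hu, hj, hp', ha'⟩ := h.exists_weight_ending_with g
      (fun j hj => hT j (by omega)) (by omega) (by omega) hv hp hl
    have h1 : a' (p + 1) = letterContent q ν l false := by rw [hj _ le_rfl, ha]
    have hkn : κ p u ≠ 0 := h.kappa_ne_zero g (by omega) (by omega) (by omega) (hT (p + 1) (by omega))
      hu (by rw [ha', h1, ← Bool.not_true, g.content_mul_not])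
    obtain ⟨u', hu'⟩ := h.next_of_kappa_ne_zero g hn (by omega) hu hkn
    obtain ⟨χ', hχ'⟩ := hT _ (by omega) _ _ hu'
    obtain ⟨k', b'', h2, h3, -⟩ := hp'.letter g hχ' fun j hj => by
      rw [Function.update_of_ne (by omega)]
    rw [Function.update_self, hj (p + 2) (by omega)] at h3
    exact ⟨k', b'', h2, h3⟩
  | true =>
    exfalso
    obtain rfl : b₀ = false := by
      cases b₀ with
      | false => rfl
      | true => exact (hl.not_adjacent hk hkl).elim
    -- The edge `k` carries a removable box. After rerouting, the last three steps are: add `k`, add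
    -- the adjacent `l`, then a letter on `k`; both kinds of the last letter are impossible.
    obtain ⟨p, a', u, rfl, hu, hj, hp', ha'⟩ := h.exists_weight_ending_with g
      (fun j hj => hT j (by omega)) (by omega) (by omega) hv hp hk
    have h1 : a' (p + 1) = letterContent q ν l true := by rw [hj _ le_rfl, ha]
    have h2 : a' (p + 2) = letterContent q ν k b' := by rw [hj _ (by omega), hx]
    have hnot := hl.not_adjacent_step hk hkl
    have hz2 : b' = true ∨ b' = false := by cases b' <;> simp
    have hne2 : a' (p + 1) ≠ a' (p + 1 + 1) := by
      rw [h1, h2]; intro h0; exact hkl' (g.content_inj h0).1.symm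
    have hkz2 : κ (p + 1) u = 0 := h.kappa_apply_eq_zero g hn (hu.2 _ (by omega))
      (hu.2 (p + 2) (by omega)) (by
        rw [h1, h2]; intro h0; exact hkl' (g.content_mul_eq_iff.mp h0).1)
    have halt := h.hecke_alternative g hn (by omega) (by omega) hu hkz2 hne2
    rcases hz2 with rfl | rfl
    · have hkz : κ p u = 0 := h.kappa_apply_eq_zero g (by omega) (hu.2 _ (by omega))
        (hu.2 (p + 1) (by omega)) (by
          rw [ha', h1]; intro h0; exact hkl' (g.content_mul_eq_iff.mp h0).1.symm)
      have halt1 := h.hecke_alternative g (by omega : p < M) (by omega) (by omega) hu hkz (by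
        rw [ha', h1]; intro h0; exact hkl' (g.content_inj h0).1)
      have e1 : (a' (p + 1) = q ^ 2 * a' p ∧ s p u = q • u) ∨
          (a' (p + 1) = (q ^ 2)⁻¹ * a' p ∧ s p u = (-q⁻¹) • u) := by
        refine halt1.resolve_left ?_
        rintro ⟨u', hu'⟩
        obtain ⟨χ', hχ'⟩ := hT (p + 1) (by omega) _ _ (hu'.mono (by omega))
        obtain ⟨k', b'', h3, h4, -⟩ := hp'.letter g hχ' fun j hj => by
          simp [Equiv.swap_apply_of_ne_of_ne (show j ≠ p by omega) (show j ≠ p + 1 by omega)]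
        simp only [Function.comp, Equiv.swap_apply_left, h1] at h4
        obtain ⟨rfl, rfl⟩ := g.content_inj h4
        exact hnot h3
      have e2 : (a' (p + 2) = q ^ 2 * a' (p + 1) ∧ s (p + 1) u = q • u) ∨
          (a' (p + 2) = (q ^ 2)⁻¹ * a' (p + 1) ∧ s (p + 1) u = (-q⁻¹) • u) := by
        refine halt.resolve_left ?_
        rintro ⟨u', hu'⟩
        obtain ⟨χ', hχ'⟩ := hT (p + 2) (by omega) _ _ (hu'.mono (by omega))
        have hp2 : IsPath q ν a' (p + 1) χ :=
          ⟨_, k, true, hp', hk.step_not, ha', (stepShape_stepShape χ k).symm⟩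
        obtain ⟨k', b'', h3, h4, -⟩ := hp2.letter g hχ' fun j hj => by
          simp [Equiv.swap_apply_of_ne_of_ne (show j ≠ p + 1 by omega) (show j ≠ p + 1 + 1 by omega)]
        simp only [Function.comp, Equiv.swap_apply_left, h2] at h4
        obtain ⟨rfl, rfl⟩ := g.content_inj h4
        simpa using hk.unique h3
      have hbr := LinearMap.congr_fun (h.braid p hn) u
      simp only [Module.End.mul_apply] at hbr
      have hq0 := g.q_ne
      have key : ∀ x z : ℂ, x ≠ 0 → z ≠ 0 → s p u = x • u → s (p + 1) u = z • u → x = z := by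
        intro x z hx hz h3 h4
        simp only [h3, h4, map_smul, smul_smul] at hbr
        have := smul_left_injective ℂ hu.1 hbr
        exact mul_left_cancel₀ (mul_ne_zero hx hz) (by linear_combination this)
      have hqi : -q⁻¹ ≠ 0 := neg_ne_zero.mpr (inv_ne_zero hq0)
      rw [ha', h1] at e1
      rw [h1, h2] at e2
      -- The contents run `k, l, k`, so the two ratios are inverse and `s p`, `s (p + 1)` would act
      -- by the different scalars `q` and `-q⁻¹`; the braid relation forces equal ones.
      rcases e1 with ⟨f1, f2⟩ | ⟨f1, f2⟩ <;> rcases e2 with ⟨f3, f4⟩ | ⟨f3, f4⟩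
      · rw [g.q_sq_mul_content] at f1 f3
        have := (g.content_inj f1).1
        have := (g.content_inj f3).1
        simp only [if_true] at *
        omega
      · exact g.q_ne_neg_inv (key _ _ hq0 hqi f2 f4)
      · exact g.q_ne_neg_inv (key _ _ hqi hq0 f2 f4).symm
      · rw [g.q_sq_inv_mul_content] at f1 f3
        have := (g.content_inj f1).1
        have := (g.content_inj f3).1
        simp only [if_true] at *
        omega
    -- Transposition would give: add `k`, remove `k`, add `l`. Then `l` could be added to the shape
    -- before `k`, contrary to `hnot`.
    · rcases halt with ⟨u', hu'⟩ | ⟨h3, -⟩ | ⟨h3, -⟩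
      · have hkn : κ p u' ≠ 0 := h.kappa_ne_zero g (by omega) (by omega) (by omega)
          (hT (p + 1) (by omega)) hu' (by
            simp only [Function.comp, Equiv.swap_apply_left,
              Equiv.swap_apply_of_ne_of_ne (show p ≠ p + 1 by omega) (show p ≠ p + 1 + 1 by omega)]
            rw [ha', h2, ← Bool.not_true, g.content_mul_not])
        obtain ⟨u'', hu''⟩ := h.next_of_kappa_ne_zero g hn (by omega) hu' hkn
        obtain ⟨χ', hχ'⟩ := hT _ (by omega) _ _ hu''
        obtain ⟨k', b'', h3, h4, -⟩ := hp'.letter g hχ' fun j hj => by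
          rw [Function.update_of_ne (by omega)]
          simp [Equiv.swap_apply_of_ne_of_ne (show j ≠ p + 1 by omega) (show j ≠ p + 1 + 1 by omega)]
        simp only [Function.comp, Function.update_self, Equiv.swap_apply_right, h1] at h4
        obtain ⟨rfl, rfl⟩ := g.content_inj h4
        exact hnot h3
      · rw [h1, h2] at h3
        simpa using (g.letters_of_q_sq (Or.inl h3)).2
      · rw [h1, h2] at h3
        simpa using (g.letters_of_q_sq (Or.inr h3)).2

/-- A product `ν ^ 2` means the inverse letter. Otherwise the Hecke alternative makes the new letter
either allowed one step earlier or adjacent to the last one. Non-adjacent letters stay allowed;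
adjacent ones either are allowed by `Allowed.step_or` or lead to `allowed_of_adjacent`. -/
lemma weightsArePaths_step [FiniteDimensional ℂ V] {n : ℕ} (hn : n < M)
    (hT : ∀ j ≤ n + 1, WeightsArePaths q ν s j) (hD : NoJordanBlocks s n) :
    WeightsArePaths q ν s (n + 2) := by
  intro a v hv
  obtain ⟨χ₁, hχ₁⟩ := hT _ le_rfl a v (hv.mono (by omega))
  have hχ₁' := hχ₁
  obtain ⟨χ, l, b, hp, hl, ha, rfl⟩ := hχ₁'
  suffices ∃ k' b'', Allowed (stepShape χ l) k' b'' ∧ a (n + 1) = letterContent q ν k' b'' by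
    obtain ⟨k', b'', h1, h2⟩ := this
    exact ⟨_, _, k', b'', hχ₁, h1, h2, rfl⟩
  by_cases hprod : a n * a (n + 1) = ν ^ 2
  · rw [ha] at hprod
    exact ⟨l, !b, hl.step_not, g.eq_content_not hprod⟩
  have y1 := hv.2 n (by omega)
  have y2 := hv.2 (n + 1) (by omega)
  have hkz : κ n v = 0 := h.kappa_apply_eq_zero g hn y1 y2 hprod
  -- Equal eigenvalues would make `y n - a n` send `s n v` to a nonzero multiple of `v`: a Jordan
  -- block of `y n`.
  have hne : a n ≠ a (n + 1) := by
    intro heq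
    have e1 : y n (s n v) - a n • s n v = (-((q - q⁻¹) * a n)) • v := by
      rw [h.jm_sigma_apply hn, y2, ← heq, map_smul, h.inv_apply g hn hkz]
      module
    have e2 := hD a (s n v) (a n) (fun j hj => by
      rw [← apply_comm (h.sigma_comm_jm hn j (by omega) (by omega) (by omega)), hv.2 j (by omega),
        map_smul]) (by rw [e1, map_smul, y1, smul_comm])
    rw [e2, sub_self] at e1
    have := (smul_eq_zero.mp e1.symm).resolve_right hv.1
    rw [neg_eq_zero] at this
    exact mul_ne_zero g.delta_ne (ha ▸ g.content_ne_zero l b) this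
  have hadj : a (n + 1) = q ^ 2 * letterContent q ν l b ∨
      a (n + 1) = (q ^ 2)⁻¹ * letterContent q ν l b →
      ∃ k' b'', Allowed (stepShape χ l) k' b'' ∧ a (n + 1) = letterContent q ν k' b'' := by
    intro h1
    obtain ⟨k, hk1, hk2⟩ := g.adjacent_of_q_sq h1
    rcases hl.step_or hk1 with h2 | h2
    · exact ⟨k, b, h2, hk2⟩
    · exact h.allowed_of_adjacent g hn hT hv hp hl ha h2 hk1 hk2
  rcases h.hecke_alternative g hn le_rfl (by omega) hv hkz hne with ⟨u, hu⟩ | ⟨h1, -⟩ | ⟨h1, -⟩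
  · obtain ⟨χ', hχ'⟩ := hT _ le_rfl _ u (hu.mono (by omega))
    obtain ⟨k, b', h2, h3, -⟩ := hp.letter g hχ' fun j hj => by
      simp [Equiv.swap_apply_of_ne_of_ne (show j ≠ n by omega) (show j ≠ n + 1 by omega)]
    simp only [Function.comp, Equiv.swap_apply_left] at h3
    by_cases hkl : k = l
    · subst hkl
      exact absurd (by rw [ha, h3, hl.unique h2]) hne
    by_cases hadj2 : k = l + 1 ∨ l = k + 1
    · exact h.allowed_of_adjacent g hn hT hv hp hl ha h2 hadj2 h3
    · exact ⟨k, b', by rwa [allowed_stepShape_iff _ _ hkl (by omega) (by omega)], h3⟩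
  · exact hadj (Or.inl (ha ▸ h1))
  · exact hadj (Or.inr (ha ▸ h1))

/-- A Jordan block of `y (n + 1)` is carried by `s n` to vectors on which `y n` has no block. This
makes `w` an eigenvector of `s n` and forces `x = q ^ (±2) * a n`; the transported vector is then
zero, against the quadratic relation, or exhibits two adjacent letters of the same kind in one
shape. -/
lemma noJordanBlocks_step [FiniteDimensional ℂ V] {n : ℕ} (hn : n < M)
    (hT : ∀ j ≤ n + 2, WeightsArePaths q ν s j) (hD : NoJordanBlocks s n) :
    NoJordanBlocks s (n + 1) := by
  intro a v x hv hw
  have hq := g.q_ne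
  set w := y (n + 1) v - x • v with hwdef
  by_contra hcon
  have hw0 : w ≠ 0 := fun h0 => hcon (sub_eq_zero.mp h0)
  have hyv : y (n + 1) v = x • v + w := by rw [hwdef]; abel
  have hwj : ∀ j < n + 1, y j w = a j • w := by
    intro j hj
    rw [hwdef, map_sub, map_smul, apply_comm (h.jm_comm (by omega) (by omega)), hv j hj, map_smul]
    module
  have hww : IsWeight s (Function.update a (n + 1) x) (n + 2) w := by
    refine ⟨hw0, fun j hj => ?_⟩
    rcases Nat.lt_succ_iff_lt_or_eq.mp hj with hj | rfl
    · rw [Function.update_of_ne (by omega), hwj j hj]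
    · rw [Function.update_self, hw]
  obtain ⟨χ₂, χ₁, k, b', ⟨χ, l, b, hp, hl, ha, rfl⟩, hk, hx, rfl⟩ := hT _ le_rfl _ w hww
  rw [Function.update_self] at hx
  rw [Function.update_of_ne (by omega)] at ha
  have hp0 : IsPath q ν a n χ := hp.congr fun j hj => by rw [Function.update_of_ne (by omega)]
  have y1 := hv n (by omega)
  have y1w := hwj n (by omega)
  have hne : a n - x ≠ 0 := by
    rw [sub_ne_zero, ha, hx]
    intro h0
    obtain ⟨rfl, rfl⟩ := g.content_inj h0
    have := hl.step_not.unique hk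
    cases b <;> simp at this
  have hkv : (a n * x - ν ^ 2) • κ n v + a n • κ n w = 0 := by
    have := LinearMap.congr_fun (h.kappa_jm_jm g hn) v
    simp only [Module.End.mul_apply, hyv, map_add, map_smul, y1, y1w, LinearMap.smul_apply] at this
    rw [sub_smul, ← this]
    module
  have han : a n ≠ 0 := ha ▸ g.content_ne_zero l b
  by_cases hprod : a n * x = ν ^ 2
  · rw [hprod, sub_self, zero_smul, zero_add] at hkv
    refine h.kappa_ne_zero g hn le_rfl (by omega) (hT (n + 1) (by omega)) hww ?_
      ((smul_eq_zero.mp hkv).resolve_left han)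
    rw [Function.update_self, Function.update_of_ne (by omega), hprod]
  have hkw0 : κ n w = 0 := h.kappa_apply_eq_zero g hn y1w hw hprod
  have hkv0 : κ n v = 0 := by
    rw [hkw0, smul_zero, add_zero] at hkv
    exact (smul_eq_zero.mp hkv).resolve_left (sub_ne_zero.mpr hprod)
  set d := q - q⁻¹ with hd
  -- `A` and `B` are chosen to cancel the `v` term and adjust the `w` term, so that `(y n - x) u = s
  -- n w + A • w`, itself in the `x`-eigenspace of `y n`.
  set A := d * x / (a n - x) with hA
  set B := (A + d) / (a n - x) with hB
  have hA' : A * (a n - x) = d * x := div_mul_cancel₀ _ hne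
  have hB' : B * (a n - x) = A + d := div_mul_cancel₀ _ hne
  have hsw : y n (s n w) = x • (s n w - d • w) := by
    rw [h.jm_sigma_apply hn, hw, map_smul, h.inv_apply g hn hkw0]
  have hsv : y n (s n v) = x • (s n v - d • v) + (s n w - d • w) := by
    rw [h.jm_sigma_apply hn, hyv, map_add, map_smul, h.inv_apply g hn hkw0, h.inv_apply g hn hkv0]
  set u := s n v + A • v + B • w with hu
  have hu1 : y n u - x • u = s n w + A • w := by
    have e : y n u - x • u = s n w + (A * (a n - x) - d * x) • v +
        (B * (a n - x) - d) • w := by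
      rw [hu, map_add, map_add, map_smul, map_smul, hsv, y1, y1w]
      module
    rw [e, hA', hB', sub_self, zero_smul]
    module
  have hu2 : y n (s n w + A • w) = x • (s n w + A • w) := by
    rw [map_add, map_smul, hsw, y1w,
      show A • a n • w = (A * (a n - x)) • w + (A * x) • w by module, hA']
    module
  have huj : ∀ j < n, y j u = a j • u := by
    intro j hj
    have hc := h.sigma_comm_jm hn j (by omega) (by omega) (by omega)
    rw [hu, map_add, map_add, map_smul, map_smul, ← apply_comm hc, hv j (by omega), hwj j (by omega),
      map_smul]
    module
  have hu3 : y n u = x • u := hD a u x huj (by rw [hu1, hu2])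
  rw [hu3, sub_self] at hu1
  have hsw' : s n w = (-A) • w := by
    rw [neg_smul]; exact eq_neg_of_add_eq_zero_left hu1.symm
  have hquad : A * A + d * A - 1 = 0 := by
    have h2 := h.sigma_sigma_apply g hn hkw0
    rw [hsw', map_smul, hsw', ← sub_eq_zero] at h2
    have : (A * A + d * A - 1) • w = 0 := by rw [← h2]; module
    exact (smul_eq_zero.mp this).resolve_right hw0
  have hcases : A = -q ∨ A = q⁻¹ := by
    have : (A + q) * (A - q⁻¹) = 0 := by
      have e : q * q⁻¹ = 1 := mul_inv_cancel₀ hq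
      rw [← hquad, hd]; linear_combination -e
    rcases mul_eq_zero.mp this with h1 | h1
    · exact Or.inl (by linear_combination h1)
    · exact Or.inr (by linear_combination h1)
  have hxq : x = q ^ 2 * a n ∨ x = (q ^ 2)⁻¹ * a n := by
    rcases hcases with h1 | h1
    · left
      rw [h1, hd] at hA'
      field_simp at hA'
      linear_combination hA'
    · right
      rw [h1, hd] at hA'
      field_simp at hA' ⊢
      linear_combination -hA'
  by_cases hu0 : u = 0
  · have hsv' : s n v = (-A) • v + (-B) • w := by
      have : s n v = u - A • v - B • w := by rw [hu]; abel
      rw [this, hu0]; module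
    have h2 := h.sigma_sigma_apply g hn hkv0
    rw [hsv', map_add, map_smul, map_smul, hsv', hsw', ← sub_eq_zero] at h2
    have h3 : (A * A + d * A - 1) • v + (B * (2 * A + d)) • w = 0 := by rw [← h2]; module
    rw [hquad, zero_smul, zero_add] at h3
    have hqs := g.q_sq_ne_neg_one
    rcases mul_eq_zero.mp ((smul_eq_zero.mp h3).resolve_right hw0) with h4 | h4
    · rw [h4, zero_mul] at hB'
      rcases hcases with h5 | h5
      · rw [h5, hd] at hB'
        apply inv_ne_zero hq
        linear_combination hB'
      · rw [h5, hd] at hB'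
        apply hq
        linear_combination -hB'
    · have e : q * q⁻¹ = 1 := mul_inv_cancel₀ hq
      rcases hcases with h5 | h5
      · rw [h5, hd] at h4
        apply hqs
        linear_combination -q * h4 - e
      · rw [h5, hd] at h4
        apply hqs
        linear_combination q * h4 - e
  · have hwt : IsWeight s (Function.update a n x) (n + 1) u := by
      refine ⟨hu0, fun j hj => ?_⟩
      rcases Nat.lt_succ_iff_lt_or_eq.mp hj with hj | rfl
      · rw [Function.update_of_ne (by omega), huj j hj]
      · rw [Function.update_self, hu3]
    obtain ⟨χ', hχ'⟩ := hT (n + 1) (by omega) _ u hwt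
    obtain ⟨k', b'', h1, h2, -⟩ := hp0.letter g hχ' fun j hj => by
      rw [Function.update_of_ne (by omega)]
    rw [Function.update_self] at h2
    rw [ha, h2] at hxq
    obtain ⟨h3, rfl⟩ := g.letters_of_q_sq hxq
    exact hl.not_adjacent h1 h3

/-- Every string of eigenvalues of the Jucys-Murphy elements is the content string of a path. -/
theorem weightsArePaths [FiniteDimensional ℂ V] {m : ℕ} (hm : m ≤ M + 1) :
    WeightsArePaths q ν s m := by
  have h0 : WeightsArePaths q ν s 0 := fun a v _ => ⟨_, rfl⟩
  have h1 : WeightsArePaths q ν s 1 := by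
    intro a v hv
    refine ⟨_, emptyShape, 0, true, rfl, ⟨by simp [emptyShape], by simp [emptyShape]⟩, ?_, rfl⟩
    have := hv.2 0 (by omega)
    rw [content_zero_true]
    simp only [jucysMurphy, Module.End.one_apply] at this
    have h2 : (a 0 - 1) • v = 0 := by rw [sub_smul, ← this, one_smul, sub_self]
    exact sub_eq_zero.mp ((smul_eq_zero.mp h2).resolve_right hv.1)
  have hD0 : NoJordanBlocks s 0 := by
    intro a v c _ h2
    simp only [jucysMurphy, Module.End.one_apply] at h2 ⊢
    have h3 : ((1 - c) * (1 - c)) • v = 0 := by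
      rw [← sub_eq_zero] at h2
      rw [← h2]; module
    by_cases hv : v = 0
    · simp [hv]
    · have := mul_self_eq_zero.mp ((smul_eq_zero.mp h3).resolve_right hv)
      rw [← sub_eq_zero.mp this, one_smul]
  -- Paths run one step ahead: length `n + 2` needs no blocks for `y n`, and no blocks for `y (n +
  -- 1)` needs paths of length `n + 2`.
  have key : ∀ n, n ≤ M → (∀ j ≤ n + 1, WeightsArePaths q ν s j) ∧ NoJordanBlocks s n := by
    intro n
    induction n with
    | zero =>
      intro _
      refine ⟨fun j hj => ?_, hD0⟩
      rcases (show j = 0 ∨ j = 1 by omega) with rfl | rfl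
      exacts [h0, h1]
    | succ n ih =>
      intro hn
      obtain ⟨hT, hD⟩ := ih (by omega)
      have hT2 := h.weightsArePaths_step g hn hT hD
      have hT' : ∀ j ≤ n + 2, WeightsArePaths q ν s j := by
        intro j hj
        rcases (show j ≤ n + 1 ∨ j = n + 2 by omega) with hj | rfl
        exacts [hT j hj, hT2]
      exact ⟨hT', h.noJordanBlocks_step g hn hT' hD⟩
  exact (key M le_rfl).1 m hm

end BMWFamily

/-! ### Counting allowed letters and multiplying their contents -/

section Counting

variable {q ν : ℂ}

/-- The empty shape has a single descent, at 0. Each step adds a second difference, whose total and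
first moment vanish. -/
lemma exists_descent_finsupp {a : ℕ → ℂ} : ∀ {m : ℕ} {χ : ℤ → Bool}, IsPath q ν a m χ →
    ∃ d : ℤ →₀ ℤ, (∀ k, d k = descent χ k) ∧ d.sum (fun _ n => n) = 1 ∧
      d.sum (fun k n => k * n) = 0
  | 0, _, rfl => by
    refine ⟨Finsupp.single 0 1, fun k => ?_, by simp, by simp⟩
    unfold descent emptyShape boolInd
    by_cases e : k = 0
    · subst e; simp
    · have : decide (k ≤ 0) = decide (k + 1 ≤ 0) := by
        rw [decide_eq_decide]; omega
      rw [this, Finsupp.single_eq_of_ne e]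
      simp
  | m + 1, _, ⟨χ', l, b, hp, hl, _, rfl⟩ => by
    obtain ⟨d, h1, h2, h3⟩ := exists_descent_finsupp hp
    refine ⟨d + (Finsupp.single (l - 1) (boolSign b) + Finsupp.single (l + 1) (boolSign b) +
      Finsupp.single l (-2 * boolSign b)), fun k => ?_, ?_, ?_⟩
    · rw [descent_step hl, ← h1]
      simp only [Finsupp.add_apply, Finsupp.single_apply]
      split_ifs <;> ring
    · simp only [Finsupp.sum_add_index' (h := fun (_ : ℤ) (n : ℤ) => n) (fun _ => rfl)
        (fun _ _ _ => rfl), h2, Finsupp.sum_single_index]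
      ring
    · have e : ∀ k : ℤ, k * (0 : ℤ) = 0 := fun k => mul_zero k
      simp only [Finsupp.sum_add_index' (h := fun (k : ℤ) (n : ℤ) => k * n) e
        (fun k n n' => mul_add k n n'), h3, Finsupp.sum_single_index, e]
      ring

lemma descent_ne_zero_iff {χ : ℤ → Bool} {k : ℤ} : descent χ k ≠ 0 ↔ Allowed χ k (χ k) := by
  unfold descent Allowed boolInd
  cases χ k <;> cases χ (k + 1) <;> simp

/-- The set of letters allowed in the shape of a path has odd cardinality, and the product of their
contents is a power of `ν`. -/
lemma exists_allowed_finset (g : GenericParams q ν) {a : ℕ → ℂ} {m : ℕ} {χ : ℤ → Bool}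
    (h : IsPath q ν a m χ) : ∃ (S : Finset ℤ) (r : ℕ), (∀ k, k ∈ S ↔ Allowed χ k (χ k)) ∧
      S.card = 2 * r + 1 ∧ ∏ k ∈ S, letterContent q ν k (χ k) = ν ^ (2 * r) ∧
      ∏ k ∈ S, letterContent q ν k (!χ k) = ν ^ (2 * r + 2) := by
  obtain ⟨d, h1, h2, h3⟩ := exists_descent_finsupp h
  have hmem : ∀ k, k ∈ d.support ↔ Allowed χ k (χ k) := fun k => by
    rw [Finsupp.mem_support_iff, h1, descent_ne_zero_iff]
  have hd : ∀ k ∈ d.support, d k = boolSign (χ k) := fun k hk => by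
    rw [h1, descent_of_allowed ((hmem k).mp hk)]
  set r := (d.support.filter (fun k => χ k = false)).card with hr
  have hcard : d.support.card = 2 * r + 1 := by
    have e1 := Finset.card_filter_add_card_filter_not (s := d.support) (fun k => χ k = false)
    -- On the support a descent is 1 for an addable box and -1 for a removable one, so total 1 makes
    -- the number of letters `2 * r + 1`.
    have e2 : ∑ k ∈ d.support, (1 - 2 * (if χ k = false then 1 else 0) : ℤ) = 1 := by
      refine Eq.trans (Finset.sum_congr rfl fun k hk => ?_) h2
      rw [hd k hk]
      cases χ k <;> simp [boolSign]
    rw [Finset.sum_sub_distrib, ← Finset.mul_sum, Finset.sum_boole] at e2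
    simp only [Finset.sum_const, nsmul_eq_mul, mul_one] at e2
    omega
  have hprod : ∏ k ∈ d.support, letterContent q ν k (χ k) = ν ^ (2 * r) := by
    -- The powers of `q` cancel by the vanishing first moment; each removable box leaves `ν ^ 2`.
    have e1 : ∀ k ∈ d.support, letterContent q ν k (χ k) =
        q ^ (2 * (k * d k)) * (if χ k = false then ν ^ 2 else 1) := by
      intro k hk
      rw [hd k hk]
      cases χ k <;> simp [letterContent, boolSign, mul_comm]
    have e2 : ∀ T : Finset ℤ, ∏ k ∈ T, q ^ (2 * (k * d k)) = q ^ (∑ k ∈ T, 2 * (k * d k)) := by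
      intro T
      induction T using Finset.cons_induction with
      | empty => simp
      | cons k T hk ih => rw [Finset.prod_cons, Finset.sum_cons, zpow_add₀ g.q_ne, ih]
    rw [Finset.prod_congr rfl e1, Finset.prod_mul_distrib, e2, ← Finset.mul_sum,
      show ∑ k ∈ d.support, k * d k = 0 from h3, mul_zero, zpow_zero, one_mul,
      Finset.prod_ite, Finset.prod_const, Finset.prod_const_one, mul_one, ← pow_mul]
  refine ⟨d.support, r, hmem, hcard, hprod, ?_⟩
  have e3 : (∏ k ∈ d.support, letterContent q ν k (χ k)) *
      ∏ k ∈ d.support, letterContent q ν k (!χ k) = ν ^ (2 * r) * ν ^ (2 * r + 2) := by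
    rw [← Finset.prod_mul_distrib, Finset.prod_congr rfl fun k _ => g.content_mul_not k (χ k),
      Finset.prod_const, hcard, ← pow_mul, ← pow_add]
    congr 1
    ring
  rw [hprod] at e3
  exact mul_left_cancel₀ (pow_ne_zero _ g.nu_ne) e3

end Counting

/-! ### From the presented algebra to operators on irreducible modules -/

section Transport

variable {A B : Type*} [Ring A] [Algebra ℂ A] [Ring B] [Algebra ℂ B]

lemma map_kappaOf (f : A →ₐ[ℂ] B) (q ν : ℂ) (x : A) : f (kappaOf q ν x) = kappaOf q ν (f x) := by
  simp only [kappaOf, map_smul, map_mul, map_sub, map_add, AlgHom.commutes]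

lemma map_jucysMurphy (f : A →ₐ[ℂ] B) (s : ℕ → A) : ∀ k,
    f (jucysMurphy s k) = jucysMurphy (fun i => f (s i)) k
  | 0 => map_one f
  | k + 1 => by simp only [jucysMurphy, map_mul, map_jucysMurphy f s k]

lemma BMWFamily.map {q ν : ℂ} {M : ℕ} {s t : ℕ → A} (h : BMWFamily q ν M s t) (f : A →ₐ[ℂ] B) :
    BMWFamily q ν M (fun i => f (s i)) (fun i => f (t i)) where
  mul_inv i hi := by rw [← map_mul, h.mul_inv i hi, map_one]
  inv_mul i hi := by rw [← map_mul, h.inv_mul i hi, map_one]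
  braid i hi := by simp only [← map_mul, h.braid i hi]
  locality i j hij hj := by simp only [← map_mul, h.locality i j hij hj]
  cubic i hi := by
    have := congrArg f (h.cubic i hi)
    simpa only [map_mul, map_sub, map_add, AlgHom.commutes, map_zero] using this
  tangle i hi := by
    simp only [← map_kappaOf, ← map_mul, ← map_smul, h.tangle i hi]
  tangle_inv i hi := by
    simp only [← map_kappaOf, ← map_mul, ← map_smul, h.tangle_inv i hi]

end Transport

namespace BMWAlgebra

variable {q ν : ℂ} {M : ℕ}

/-- The generators of the algebra, indexed by the natural numbers. -/
noncomputable def sigmaNat (q ν : ℂ) (M : ℕ) (i : ℕ) : BMWAlgebra q ν M :=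
  if h : i < M then sigma q ν ⟨i, h⟩ else 1

/-- The inverses of the generators, indexed by the natural numbers. -/
noncomputable def sigmaInvNat (q ν : ℂ) (M : ℕ) (i : ℕ) : BMWAlgebra q ν M :=
  if h : i < M then RingQuot.mkAlgHom ℂ (BMWRel q ν M) (freeSigmaInv ⟨i, h⟩) else 1

lemma sigmaNat_of_lt {i : ℕ} (h : i < M) : sigmaNat q ν M i = sigma q ν ⟨i, h⟩ := dif_pos h

lemma sigmaInvNat_of_lt {i : ℕ} (h : i < M) :
    sigmaInvNat q ν M i = RingQuot.mkAlgHom ℂ (BMWRel q ν M) (freeSigmaInv ⟨i, h⟩) := dif_pos h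

lemma bmwFamily (q ν : ℂ) (M : ℕ) : BMWFamily q ν M (sigmaNat q ν M) (sigmaInvNat q ν M) where
  mul_inv i hi := by
    rw [sigmaNat_of_lt hi, sigmaInvNat_of_lt hi, sigma, ← map_mul,
      RingQuot.mkAlgHom_rel ℂ (BMWRel.mul_inv _), map_one]
  inv_mul i hi := by
    rw [sigmaNat_of_lt hi, sigmaInvNat_of_lt hi, sigma, ← map_mul,
      RingQuot.mkAlgHom_rel ℂ (BMWRel.inv_mul _), map_one]
  braid i hi := by
    rw [sigmaNat_of_lt (by omega : i < M), sigmaNat_of_lt hi, sigma, sigma]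
    simp only [← map_mul]
    exact RingQuot.mkAlgHom_rel ℂ (BMWRel.braid ⟨i, by omega⟩ ⟨i + 1, hi⟩ rfl)
  locality i j hij hj := by
    rw [sigmaNat_of_lt (by omega : i < M), sigmaNat_of_lt hj, sigma, sigma]
    simp only [← map_mul]
    exact RingQuot.mkAlgHom_rel ℂ (BMWRel.locality ⟨i, by omega⟩ ⟨j, hj⟩ hij)
  cubic i hi := by
    have := RingQuot.mkAlgHom_rel ℂ (BMWRel.cubic (q := q) (ν := ν) ⟨i, hi⟩)
    rw [sigmaNat_of_lt hi, sigma]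
    simpa only [map_mul, map_sub, map_add, AlgHom.commutes, map_zero] using this
  tangle i hi := by
    have := RingQuot.mkAlgHom_rel ℂ (BMWRel.tangle (q := q) (ν := ν) ⟨i, by omega⟩ ⟨i + 1, hi⟩ rfl)
    rw [sigmaNat_of_lt (by omega : i < M), sigmaNat_of_lt hi, sigma, sigma]
    simpa only [map_mul, map_kappaOf, map_smul] using this
  tangle_inv i hi := by
    have := RingQuot.mkAlgHom_rel ℂ
      (BMWRel.tangle_inv (q := q) (ν := ν) ⟨i, by omega⟩ ⟨i + 1, hi⟩ rfl)
    rw [sigmaNat_of_lt (by omega : i < M), sigmaInvNat_of_lt hi, sigma]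
    simpa only [map_mul, map_kappaOf, map_smul] using this

lemma jucysMurphy_sigmaNat : ∀ {k : ℕ} (hk : k < M + 1),
    jucysMurphy (sigmaNat q ν M) k = jm q ν ⟨k, hk⟩
  | 0, _ => rfl
  | k + 1, hk => by
    have hkM : k < M := by omega
    change sigmaNat q ν M k * jucysMurphy (sigmaNat q ν M) k * sigmaNat q ν M k = _
    rw [jucysMurphy_sigmaNat (by omega : k < M + 1), sigmaNat_of_lt hkM]
    rfl

/-- The representation afforded by an irreducible module. -/
noncomputable def Irrep.rep (V : Irrep q ν M) : BMWAlgebra q ν M →ₐ[ℂ] Module.End ℂ V.carrier :=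
  haveI : SMulCommClass (BMWAlgebra q ν M) ℂ V.carrier := IsScalarTower.to_smulCommClass'
  Algebra.lsmul ℂ ℂ V.carrier

lemma Irrep.rep_apply (V : Irrep q ν M) (x : BMWAlgebra q ν M) (v : V.carrier) :
    V.rep x v = x • v := rfl

/-- The operators by which the generators act on an irreducible module. -/
noncomputable def Irrep.sigmaOp (V : Irrep q ν M) (i : ℕ) : Module.End ℂ V.carrier :=
  V.rep (sigmaNat q ν M i)

lemma Irrep.bmwFamily (V : Irrep q ν M) :
    BMWFamily q ν M V.sigmaOp (fun i => V.rep (sigmaInvNat q ν M i)) :=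
  (BMWAlgebra.bmwFamily q ν M).map V.rep

lemma Irrep.sigmaOp_apply (V : Irrep q ν M) (i : Fin M) (v : V.carrier) :
    V.sigmaOp i v = sigma q ν i • v := by
  rw [Irrep.sigmaOp, sigmaNat_of_lt i.2]; rfl

lemma Irrep.kappaOf_sigmaOp_apply (V : Irrep q ν M) (i : Fin M) (v : V.carrier) :
    kappaOf q ν (V.sigmaOp i) v = kappa q ν i • v := by
  rw [Irrep.sigmaOp, ← map_kappaOf, sigmaNat_of_lt i.2]; rfl

lemma Irrep.jucysMurphy_sigmaOp_apply (V : Irrep q ν M) {j : ℕ} (hj : j < M + 1) (v : V.carrier) :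
    jucysMurphy V.sigmaOp j v = jm q ν ⟨j, hj⟩ • v := by
  rw [← jucysMurphy_sigmaNat, ← Irrep.rep_apply, map_jucysMurphy]; rfl

/-- Extension of a string by zeros. -/
def extendString (α : Fin (M + 1) → ℂ) (j : ℕ) : ℂ := if h : j < M + 1 then α ⟨j, h⟩ else 0

lemma extendString_of_lt (α : Fin (M + 1) → ℂ) {j : ℕ} (h : j < M + 1) :
    extendString α j = α ⟨j, h⟩ := dif_pos h

lemma isWeight_iff (V : Irrep q ν M) {α : Fin (M + 1) → ℂ} {a : ℕ → ℂ} (ha : ∀ j : Fin (M + 1), a j = α j)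
    (v : V.carrier) : IsWeight V.sigmaOp a (M + 1) v ↔ IsJMEigenvector V α v := by
  refine and_congr Iff.rfl ⟨fun h j => ?_, fun h j hj => ?_⟩
  · rw [← ha, ← h j j.2, V.jucysMurphy_sigmaOp_apply j.2]
  · rw [V.jucysMurphy_sigmaOp_apply hj, h ⟨j, hj⟩, ha ⟨j, hj⟩]

lemma extendString_val (α : Fin (M + 1) → ℂ) (j : Fin (M + 1)) : extendString α j = α j :=
  extendString_of_lt α j.2

/-- Every string of the spectrum is the content string of a path; in positions `i` and `i + 1`. -/
lemma exists_letters (g : GenericParams q ν) {α : Fin (M + 1) → ℂ} (hα : α ∈ jmSpec q ν M) (i : Fin M) :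
    ∃ χ l b k b', IsPath q ν (extendString α) i χ ∧ Allowed χ l b ∧
      α i.castSucc = letterContent q ν l b ∧ Allowed (stepShape χ l) k b' ∧
      α i.succ = letterContent q ν k b' := by
  obtain ⟨V, v, hv⟩ := hα
  have hw := (isWeight_iff V (extendString_val α) v).mpr hv
  have hi := i.2
  obtain ⟨_, _, k, b', ⟨χ, l, b, h1, h2, h3, rfl⟩, h5, h6, -⟩ :=
    V.bmwFamily.weightsArePaths g (by omega : (i : ℕ) + 2 ≤ M + 1) _ _ (hw.mono (by omega))
  rw [extendString_of_lt α (by omega)] at h3 h6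
  exact ⟨χ, l, b, k, b', h1, h2, h3, h5, h6⟩

lemma swap_extendString (α : Fin (M + 1) → ℂ) (i : Fin M) (j : Fin (M + 1)) :
    (extendString α ∘ Equiv.swap (i : ℕ) (i + 1)) j = (α ∘ Equiv.swap i.castSucc i.succ) j := by
  simp only [Function.comp]
  by_cases h1 : j = i.castSucc
  · subst h1
    rw [Equiv.swap_apply_left, ← extendString_val α i.succ]
    simp
  by_cases h2 : j = i.succ
  · subst h2
    rw [Equiv.swap_apply_right, ← extendString_val α i.castSucc]
    simp
  rw [Equiv.swap_apply_of_ne_of_ne h1 h2, Equiv.swap_apply_of_ne_of_ne, extendString_val]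
  · exact fun h => h1 (Fin.ext h)
  · exact fun h => h2 (Fin.ext h)

lemma apply_castSucc_ne (g : GenericParams q ν) {α : Fin (M + 1) → ℂ} (hα : α ∈ jmSpec q ν M)
    (i : Fin M) : α i.castSucc ≠ α i.succ := by
  obtain ⟨χ, l, b, k, b', -, h2, h3, h4, h5⟩ := exists_letters g hα i
  rw [h3, h5]
  intro h0
  obtain ⟨rfl, rfl⟩ := g.content_inj h0
  have := h2.step_not.unique h4
  cases b <;> simp at this

lemma kappa_smul_eq_zero (g : GenericParams q ν) {α : Fin (M + 1) → ℂ} (i : Fin M)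
    (hprod : α i.castSucc * α i.succ ≠ ν ^ 2) (V : Irrep q ν M) (v : V.carrier)
    (hv : IsJMEigenvector V α v) : kappa q ν i • v = 0 := by
  have hw := (isWeight_iff V (extendString_val α) v).mpr hv
  have hi := i.2
  rw [← V.kappaOf_sigmaOp_apply]
  refine V.bmwFamily.kappa_apply_eq_zero g hi (hw.2 i (by omega)) (hw.2 (i + 1) (by omega)) ?_
  rw [extendString_of_lt _ (by omega), extendString_of_lt _ (by omega)]
  exact hprod

lemma sigma_alternative (g : GenericParams q ν) {α : Fin (M + 1) → ℂ} (i : Fin M)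
    (hprod : α i.castSucc * α i.succ ≠ ν ^ 2) (V : Irrep q ν M) (v : V.carrier)
    (hv : IsJMEigenvector V α v) :
    (∃ u : V.carrier, IsJMEigenvector V (α ∘ Equiv.swap i.castSucc i.succ) u) ∨
      (α i.succ = q ^ 2 * α i.castSucc ∧ sigma q ν i • v = q • v) ∨
      (α i.succ = (q ^ 2)⁻¹ * α i.castSucc ∧ sigma q ν i • v = (-q⁻¹) • v) := by
  have hw := (isWeight_iff V (extendString_val α) v).mpr hv
  have hi := i.2
  have hk := kappa_smul_eq_zero g i hprod V v hv
  rw [← V.kappaOf_sigmaOp_apply] at hk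
  have e1 : extendString α (i : ℕ) = α i.castSucc := extendString_val α i.castSucc
  have e2 : extendString α ((i : ℕ) + 1) = α i.succ := extendString_val α i.succ
  have := V.bmwFamily.hecke_alternative g hi (by omega) le_rfl hw hk (by
    rw [e1, e2]; exact apply_castSucc_ne g ⟨V, v, hv⟩ i)
  rw [e1, e2, V.sigmaOp_apply] at this
  refine this.imp_left ?_
  rintro ⟨u, hu⟩
  exact ⟨u, (isWeight_iff V (swap_extendString α i) u).mp hu⟩

lemma isPath_congr_prefix {α γ : Fin (M + 1) → ℂ} {i : Fin M} {χ : ℤ → Bool}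
    (h : ∀ j : Fin (M + 1), j ≠ i.castSucc → j ≠ i.succ → γ j = α j)
    (hp : IsPath q ν (extendString γ) i χ) : IsPath q ν (extendString α) i χ := by
  refine hp.congr fun j hj => ?_
  have hi := i.2
  rw [extendString_of_lt _ (by omega), extendString_of_lt _ (by omega)]
  exact h _ (fun e => by simp [Fin.ext_iff] at e; omega) (fun e => by simp [Fin.ext_iff] at e; omega)

/-- Both strings reach the same shape before position `i`, so two adjacent letters of the same kind
would be allowed in it. -/
lemma swap_not_mem_jmSpec (g : GenericParams q ν) {α : Fin (M + 1) → ℂ} (hα : α ∈ jmSpec q ν M)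
    (i : Fin M)
    (h : α i.succ = q ^ 2 * α i.castSucc ∨ α i.succ = (q ^ 2)⁻¹ * α i.castSucc) :
    (α ∘ Equiv.swap i.castSucc i.succ) ∉ jmSpec q ν M := by
  intro hmem
  obtain ⟨χ, l, b, k, b', h1, h2, h3, h4, h5⟩ := exists_letters g hα i
  obtain ⟨χ', l', b'', k', b''', h1', h2', h3', -, -⟩ := exists_letters g hmem i
  have hpre := isPath_congr_prefix (α := α) (fun j hj1 hj2 => by
    simp [Equiv.swap_apply_of_ne_of_ne hj1 hj2]) h1'
  obtain rfl := h1.unique g hpre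
  simp only [Function.comp, Equiv.swap_apply_left] at h3'
  rw [h3, h3'] at h
  obtain ⟨h6, rfl⟩ := g.letters_of_q_sq h
  exact h2.not_adjacent h2' h6

end BMWAlgebra

/-! ### The theorem -/

theorem proposition4 (q ν : ℂ)
    (hq0 : q ≠ 0) (hq : ∀ k : ℕ, 0 < k → q ^ k ≠ 1)
    (hν0 : ν ≠ 0) (hν : ∀ k : ℤ, ν ≠ q ^ k ∧ ν ≠ -q ^ k)
    (M : ℕ) (α : Fin (M + 1) → ℂ) (hα : α ∈ BMWAlgebra.jmSpec q ν M) :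
    -- (1)
    (∀ j : Fin (M + 1), ∃ z : ℤ, α j = q ^ (2 * z) ∨ α j = ν ^ 2 * q ^ (2 * z)) ∧
    -- (2)
    (∀ i : Fin M, α i.castSucc ≠ α i.succ) ∧
    -- (3a), upper sign
    (∀ i : Fin M, α i.castSucc * α i.succ ≠ ν ^ 2 →
      α i.succ = q ^ (2 : ℤ) * α i.castSucc →
      ∀ (V : BMWAlgebra.Irrep q ν M) (v : V.carrier), BMWAlgebra.IsJMEigenvector V α v →
        BMWAlgebra.sigma q ν i • v = q • v ∧ BMWAlgebra.kappa q ν i • v = 0) ∧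
    -- (3a), lower sign
    (∀ i : Fin M, α i.castSucc * α i.succ ≠ ν ^ 2 →
      α i.succ = q ^ (-2 : ℤ) * α i.castSucc →
      ∀ (V : BMWAlgebra.Irrep q ν M) (v : V.carrier), BMWAlgebra.IsJMEigenvector V α v →
        BMWAlgebra.sigma q ν i • v = (-q⁻¹) • v ∧ BMWAlgebra.kappa q ν i • v = 0) ∧
    -- (3b)
    (∀ i : Fin M, α i.castSucc * α i.succ ≠ ν ^ 2 →
      α i.succ ≠ q ^ (2 : ℤ) * α i.castSucc →
      α i.succ ≠ q ^ (-2 : ℤ) * α i.castSucc →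
      (α ∘ Equiv.swap i.castSucc i.succ) ∈ BMWAlgebra.jmSpec q ν M ∧
      (∀ (V : BMWAlgebra.Irrep q ν M) (v : V.carrier), BMWAlgebra.IsJMEigenvector V α v →
        BMWAlgebra.kappa q ν i • v = 0) ∧
      (∀ (V : BMWAlgebra.Irrep q ν M) (v : V.carrier),
        BMWAlgebra.IsJMEigenvector V (α ∘ Equiv.swap i.castSucc i.succ) v →
        BMWAlgebra.kappa q ν i • v = 0)) ∧
    -- (4)
    (∀ i : Fin M, α i.castSucc * α i.succ = ν ^ 2 →
      ∃ (m : ℕ) (β : Fin (2 * m + 1) → (Fin (M + 1) → ℂ)),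
        Function.Injective β ∧
        Set.range β = {γ | γ ∈ BMWAlgebra.jmSpec q ν M ∧
          (∀ j : Fin (M + 1), j ≠ i.castSucc → j ≠ i.succ → γ j = α j) ∧
          γ i.castSucc * γ i.succ = ν ^ 2} ∧
        α ∈ Set.range β ∧
        ∏ k, β k i.castSucc = ν ^ (2 * m) ∧
        ∏ k, β k i.succ = ν ^ (2 * m + 2)) := by
  have g : GenericParams q ν := ⟨hq0, hq, hν0, hν⟩
  have z1 : q ^ (2 : ℤ) = q ^ 2 := by norm_cast
  have z2 : q ^ (-2 : ℤ) = (q ^ 2)⁻¹ := by rw [zpow_neg, z1]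
  have hα0 : ∀ j : Fin (M + 1), α j ≠ 0 ∧
      ∃ z : ℤ, α j = q ^ (2 * z) ∨ α j = ν ^ 2 * q ^ (2 * z) := by
    intro j
    obtain ⟨V, v, hv⟩ := hα
    have hw := (BMWAlgebra.isWeight_iff V (BMWAlgebra.extendString_val α) v).mpr hv
    obtain ⟨_, χ, l, b, -, -, h3, -⟩ :=
      V.bmwFamily.weightsArePaths g (by omega : (j : ℕ) + 1 ≤ M + 1) _ _ (hw.mono (by omega))
    rw [BMWAlgebra.extendString_val] at h3
    refine ⟨h3 ▸ g.content_ne_zero l b, ?_⟩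
    cases b with
    | true => exact ⟨l, Or.inl (by rw [h3]; rfl)⟩
    | false => exact ⟨-l, Or.inr (by rw [h3, mul_neg]; rfl)⟩
  -- Separates the two signs in (3a), so that the ratio of the eigenvalues decides the eigenvalue of
  -- `sigma`.
  have hq4 : q ^ 2 ≠ (q ^ 2)⁻¹ := by
    intro h0
    apply hq 4 (by norm_num)
    have := mul_inv_cancel₀ (pow_ne_zero 2 hq0)
    rw [← h0] at this
    linear_combination this
  refine ⟨fun j => (hα0 j).2, BMWAlgebra.apply_castSucc_ne g hα, ?_, ?_, ?_, ?_⟩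
  · intro i hprod h1 V v hv
    rw [z1] at h1
    refine ⟨?_, BMWAlgebra.kappa_smul_eq_zero g i hprod V v hv⟩
    rcases BMWAlgebra.sigma_alternative g i hprod V v hv with ⟨u, hu⟩ | ⟨-, h2⟩ | ⟨h2, -⟩
    · exact absurd ⟨V, u, hu⟩ (BMWAlgebra.swap_not_mem_jmSpec g hα i (Or.inl h1))
    · exact h2
    · exact absurd (mul_right_cancel₀ (hα0 _).1 (h1.symm.trans h2)) hq4
  · intro i hprod h1 V v hv
    rw [z2] at h1
    refine ⟨?_, BMWAlgebra.kappa_smul_eq_zero g i hprod V v hv⟩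
    rcases BMWAlgebra.sigma_alternative g i hprod V v hv with ⟨u, hu⟩ | ⟨h2, -⟩ | ⟨-, h2⟩
    · exact absurd ⟨V, u, hu⟩ (BMWAlgebra.swap_not_mem_jmSpec g hα i (Or.inr h1))
    · exact absurd (mul_right_cancel₀ (hα0 _).1 (h2.symm.trans h1)) hq4
    · exact h2
  · intro i hprod h1 h2
    rw [z1] at h1
    rw [z2] at h2
    refine ⟨?_, fun V v hv => BMWAlgebra.kappa_smul_eq_zero g i hprod V v hv,
      fun V v hv => BMWAlgebra.kappa_smul_eq_zero g i (by
        simpa only [Function.comp, Equiv.swap_apply_left, Equiv.swap_apply_right, mul_comm] using hprod)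
        V v hv⟩
    obtain ⟨V, v, hv⟩ := hα
    rcases BMWAlgebra.sigma_alternative g i hprod V v hv with ⟨u, hu⟩ | ⟨h3, -⟩ | ⟨h3, -⟩
    · exact ⟨V, u, hu⟩
    · exact absurd h3 h1
    · exact absurd h3 h2
  · intro i hprod
    obtain ⟨χ, -, -, -, -, hp, -, -, -, -⟩ := BMWAlgebra.exists_letters g hα i
    obtain ⟨S, m, hS, hcard, hprod1, hprod2⟩ := exists_allowed_finset g hp
    let e : S ≃ Fin (2 * m + 1) := S.equivFinOfCardEq hcard
    -- The candidate strings: positions `i` and `i + 1` carry a letter allowed in `χ` followed by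
    -- its inverse.
    let β : ℤ → Fin (M + 1) → ℂ := fun k => Function.update (Function.update α i.castSucc
      (letterContent q ν k (χ k))) i.succ (letterContent q ν k (!χ k))
    have hi := i.2
    have hne : i.castSucc ≠ i.succ := by simp [Fin.ext_iff]
    have hβ1 : ∀ k, β k i.castSucc = letterContent q ν k (χ k) := fun k => by
      simp only [β, Function.update_of_ne hne, Function.update_self]
    have hβ2 : ∀ k, β k i.succ = letterContent q ν k (!χ k) := fun k => by
      simp only [β, Function.update_self]
    have hrange : Set.range (fun x => β (e.symm x)) = {γ | γ ∈ BMWAlgebra.jmSpec q ν M ∧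
          (∀ j : Fin (M + 1), j ≠ i.castSucc → j ≠ i.succ → γ j = α j) ∧
          γ i.castSucc * γ i.succ = ν ^ 2} := by
      ext γ
      constructor
      · rintro ⟨x, rfl⟩
        have hx := (hS _).mp (e.symm x).2
        beta_reduce
        generalize ((e.symm x : S) : ℤ) = k at hx ⊢
        refine ⟨?_, fun j h1 h2 => ?_, ?_⟩
        · obtain ⟨V, v, hv⟩ := hα
          have hw := (BMWAlgebra.isWeight_iff V (BMWAlgebra.extendString_val α) v).mpr hv
          have e1 : BMWAlgebra.extendString α (i : ℕ) = α i.castSucc := BMWAlgebra.extendString_val α i.castSucc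
          have e2 : BMWAlgebra.extendString α ((i : ℕ) + 1) = α i.succ := BMWAlgebra.extendString_val α i.succ
          have hk := V.bmwFamily.kappa_ne_zero g hi (by omega) le_rfl
            (V.bmwFamily.weightsArePaths g (by omega)) hw (by rw [e1, e2, hprod])
          obtain ⟨u, hu⟩ := V.bmwFamily.kappa_move g hi (by omega) le_rfl hw hk hp hx
          refine ⟨V, u, (BMWAlgebra.isWeight_iff V (fun j => ?_) u).mp hu⟩
          by_cases h2 : j = i.succ
          · subst h2
            rw [hβ2, Fin.val_succ, Function.update_self]
          by_cases h1 : j = i.castSucc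
          · subst h1
            rw [hβ1, Fin.val_castSucc, Function.update_of_ne (by omega), Function.update_self]
          · simp only [β, Function.update_of_ne h2, Function.update_of_ne h1]
            rw [Function.update_of_ne, Function.update_of_ne, BMWAlgebra.extendString_val]
            · exact fun h => h1 (Fin.ext h)
            · exact fun h => h2 (Fin.ext h)
        · simp only [β, Function.update_of_ne h2, Function.update_of_ne h1]
        · simp only [hβ1, hβ2, g.content_mul_not]
      · rintro ⟨hγ, h1, h2⟩
        obtain ⟨χ', l, b, -, -, hp', hl, h3, -, -⟩ := BMWAlgebra.exists_letters g hγ i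
        obtain rfl := hp.unique g (BMWAlgebra.isPath_congr_prefix h1 hp')
        obtain rfl := hl.1
        refine ⟨e ⟨l, (hS l).mpr hl⟩, ?_⟩
        funext j
        simp only [Equiv.symm_apply_apply]
        by_cases h5 : j = i.succ
        · subst h5
          rw [h3] at h2
          rw [hβ2, g.eq_content_not h2]
        by_cases h4 : j = i.castSucc
        · subst h4
          rw [hβ1, h3]
        · simp only [β, Function.update_of_ne h5, Function.update_of_ne h4]
          exact (h1 j h4 h5).symm
    refine ⟨m, fun x => β (e.symm x), ?_, hrange, ?_, ?_, ?_⟩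
    · intro x x' hxx
      have h1 := congrFun hxx i.castSucc
      simp only [hβ1] at h1
      exact e.symm.injective (Subtype.ext (g.content_inj h1).1)
    · rw [hrange]
      exact ⟨hα, fun _ _ _ => rfl, hprod⟩
    · simp only [hβ1]
      rw [Equiv.prod_comp e.symm (fun k : S => letterContent q ν k (χ k)),
        Finset.prod_coe_sort S (fun k => letterContent q ν k (χ k)), hprod1]
    · simp only [hβ2]
      rw [Equiv.prod_comp e.symm (fun k : S => letterContent q ν k (!χ k)),
        Finset.prod_coe_sort S (fun k => letterContent q ν k (!χ k)), hprod2]
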